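/- Let $A$ be an infinite dimensional stably finite simple unital $C^*$-algebra with real rank zero such that the order on projections over $A$ is determined by traces, that is: whenever $p,q\in M_\infty(A)=\bigcup_k M_k(A)$ are projections with $\tau(p)<\tau(q)$ for every tracial state $\tau$ of $A$ (extended to matrices by $\tau((a_{ij}))=\sum_i\tau(a_{ii})$), then $p$ is Murray–von Neumann subequivalent to $q$. Let $G$ be a finite group of order $n$ and let $\alpha\colon G\to\operatorname{Aut}(A)$ be an action with the tracial Rokhlin property: for every finite set $S\subset A$, every $\delta>0$ and every positive $x\in A$ with $\|x\|=1$ there are mutually orthogonal projections $e_g\in A$ $(g\in G)$ such that, with $e_0=\sum_{g\in G}e_g$, - $\|\alpha_g(e_h)-e_{gh}\|<\delta$ for all $g,h\in G$; - $\|e_ga-ae_g\|<\delta$ for all $g\in G$ and $a\in S$; - $1-e_0$ is Murray–von Neumann equivalent in $A$ to a projection in the hereditary subalgebra $\overline{xAx}$ generated by $x$; - $\|e_0xe_0\|>1-\delta$. Let $C^*(G,A,\alpha)$ be the crossed product and let $\iota\colon A\to C^*(G,A,\alpha)$ be the inclusion map. Then for every finite set $F\subset C^*(G,A,\alpha)$,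 every $\varepsilon>0$, every $N\in\mathbb N$ and every nonzero positive element $z\in C^*(G,A,\alpha)$ there exist projections $e,f\in A$, a $C^*$-subalgebra $D\subset \iota(e)\,C^*(G,A,\alpha)\,\iota(e)$ containing the unit $\iota(e)$, and a $*$-isomorphism $\varphi\colon M_n\otimes fAf\to D$ such that, with the matrix units $(e_{g,h})_{g,h\in G}$ of $M_n$ indexed by $G$ (the index $1$ is the identity of $G$, and in $e_{g,g}\otimes 1$ the second $1$ is the unit $f$ of $fAf$): 1. $\varphi(e_{1,1}\otimes a)=\iota(a)$ for all $a\in fAf$, and $\varphi(e_{g,g}\otimes 1)\in\iota(A)$ for all $g\in G$. 2. $\|\varphi(e_{g,g}\otimes a)-\iota(\alpha_g(a))\|\le\varepsilon\|a\|$ for all $g\in G$ and all $a\in fAf$. 3. For every $a\in F$ there exist $b_1,b_2\in D$ such that $\|\iota(e)a-b_1\|<\varepsilon$, $\|a\,\iota(e)-b_2\|<\varepsilon$ and $\|b_1\|,\|b_2\|\le\|a\|$. 4. $\iota(e)=\sum_{g\in G}\varphi(e_{g,g}\otimes 1)$. 5. $1-\iota(e)$ is Murray–von Neumann equivalent in $C^*(G,A,\alpha)$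 to a projection in the hereditary subalgebra of $C^*(G,A,\alpha)$ generated by $z$. 6. There are $N$ mutually orthogonal projections $f_1,\dots,f_N\in \iota(e)D\iota(e)$, each of which is Murray–von Neumann equivalent in $C^*(G,A,\alpha)$ to $1-\iota(e)$. -/

import Mathlib

noncomputable section

/-! ### Projections, corners, and structural properties of C⋆-algebras -/

/-- Murray–von Neumann equivalence of `p` and `q` in `A`: `p = v⋆v` and `q = vv⋆` for some `v ∈ A`. -/
def MvNEquiv {A : Type*} [Mul A] [Star A] (p q : A) : Prop :=
  ∃ v : A, star v * v = p ∧ v * star v = q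

/-- Murray–von Neumann subequivalence: `p` is equivalent to a projection `r ≤ q`
(for projections, `r ≤ q` means `q r = r`). -/
def MvNSubequiv {A : Type*} [Mul A] [Star A] (p q : A) : Prop :=
  ∃ r : A, IsStarProjection r ∧ q * r = r ∧ MvNEquiv p r

/-- The hereditary C⋆-subalgebra of `A` generated by a positive element `x`, that is, the norm
closure of `x A x` (as a set). -/
def hereditaryClosure {A : Type*} [CStarAlgebra A] (x : A) : Set A :=
  closure (Set.range fun a : A => x * a * x)

/-- The corner `f A f` of a projection `f`; it is a C⋆-algebra with unit `f`. -/
def corner {A : Type*} [CStarAlgebra A] (f : A) (hf : IsStarProjection f) :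
    NonUnitalStarSubalgebra ℂ A where
  carrier := {a | f * a * f = a}
  add_mem' := by
    intro a b ha hb
    simp only [Set.mem_ofPred_eq] at ha hb ⊢
    rw [mul_add, add_mul, ha, hb]
  zero_mem' := by simp
  mul_mem' := by
    intro a b ha hb
    simp only [Set.mem_ofPred_eq] at ha hb ⊢
    have hff : f * f = f := hf.isIdempotentElem
    have h1 : f * a = a := by
      rw [← ha]; simp only [← mul_assoc, hff]
    have h2 : b * f = b := by
      rw [← hb]; simp only [mul_assoc, hff]
    rw [← mul_assoc, h1, mul_assoc, h2]
  smul_mem' := by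
    intro c a ha
    simp only [Set.mem_ofPred_eq] at ha ⊢
    rw [mul_smul_comm, smul_mul_assoc, ha]
  star_mem' := by
    intro a ha
    simp only [Set.mem_ofPred_eq] at ha ⊢
    have hs : star f = f := hf.isSelfAdjoint
    conv_rhs => rw [← ha]
    simp only [star_mul, hs, mul_assoc]

/-- The unit `f` of the corner `f A f`. -/
def cornerUnit {A : Type*} [CStarAlgebra A] (f : A) (hf : IsStarProjection f) : corner f hf :=
  ⟨f, by
    have hff : f * f = f := hf.isIdempotentElem
    change f * f * f = f
    rw [hff, hff]⟩

/-- Simplicity of a C⋆-algebra: nonzero, and no closed two-sided ideals besides `0` and `A`. -/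
def IsSimpleCStar (A : Type*) [CStarAlgebra A] : Prop :=
  Nontrivial A ∧ ∀ I : TwoSidedIdeal A, IsClosed {x : A | x ∈ I} → I = ⊥ ∨ I = ⊤

/-- Stable finiteness: in every `M_n(A)` each isometry is a unitary. -/
def IsStablyFinite (A : Type*) [CStarAlgebra A] : Prop :=
  ∀ (n : ℕ) (v : Matrix (Fin n) (Fin n) A), star v * v = 1 → v * star v = 1

/-- Real rank zero for unital `A`: the invertible selfadjoint elements are dense in the selfadjoint
elements. -/
def HasRealRankZero (A : Type*) [CStarAlgebra A] : Prop :=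
  ∀ a : A, IsSelfAdjoint a → ∀ ε : ℝ, 0 < ε →
    ∃ b : A, IsSelfAdjoint b ∧ IsUnit b ∧ ‖a - b‖ < ε

/-- `τ` is a tracial state on the unital C⋆-algebra `A`. -/
structure IsTracialState {A : Type*} [CStarAlgebra A] (τ : A →L[ℂ] ℂ) : Prop where
  map_one : τ 1 = 1
  nonneg : ∀ a : A, 0 ≤ (τ (star a * a)).re ∧ (τ (star a * a)).im = 0
  trace : ∀ a b : A, τ (a * b) = τ (b * a)

/-- The order on projections over `A` is determined by traces. Two projections of
`M_∞(A) = ⋃ M_n(A)` lie in a common `M_n(A)`, `τ` is extended to `M_n(A)` by `p ↦ ∑ i, τ (p i i)`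
(real on projections), and subequivalence in `M_∞(A)` is subequivalence in `M_n(A)`. -/
def OrderDeterminedByTraces (A : Type*) [CStarAlgebra A] : Prop :=
  ∀ (n : ℕ) (p q : Matrix (Fin n) (Fin n) A), IsStarProjection p → IsStarProjection q →
    (∀ τ : A →L[ℂ] ℂ, IsTracialState τ → (∑ i, τ (p i i)).re < (∑ i, τ (q i i)).re) →
    MvNSubequiv p q

/-- The tracial Rokhlin property of an action `α` of a finite group on `A`. -/
def HasTracialRokhlinProperty {A G : Type*} [CStarAlgebra A] [PartialOrder A] [StarOrderedRing A]
    [Group G] [Fintype G] (α : G →* (A ≃⋆ₐ[ℂ] A)) : Prop :=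
  ∀ (F : Finset A) (ε : ℝ), 0 < ε → ∀ x : A, 0 ≤ x → ‖x‖ = 1 →
    ∃ e : G → A,
      (∀ g, IsStarProjection (e g)) ∧
      (∀ g h, g ≠ h → e g * e h = 0) ∧
      (∀ g h, ‖α g (e h) - e (g * h)‖ < ε) ∧
      (∀ g, ∀ a ∈ F, ‖e g * a - a * e g‖ < ε) ∧
      (∃ p, IsStarProjection p ∧ p ∈ hereditaryClosure x ∧ MvNEquiv (1 - ∑ g, e g) p) ∧
      1 - ε < ‖(∑ g, e g) * x * (∑ g, e g)‖

/-! ### The crossed product by a finite group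

For finite `G` the crossed product consists of the finite sums `∑ s, x s • u s`, `x : G → A`. It is
realized concretely in the regular representation on `ℓ²(G, A)`, i.e. inside the C⋆-algebra of
`G × G` matrices over `A`, where `a ∈ A` acts as the diagonal matrix with entries `α g⁻¹ a` and
`u s` as left translation, so that `∑ s, x s • u s` has `(g, h)` entry `α g⁻¹ (x (g h⁻¹))`.
The universal property of the full crossed product is proved below. -/

section CrossedProduct

theorem act_act {A G : Type*} [CStarAlgebra A] [Group G] (α : G →* (A ≃⋆ₐ[ℂ] A)) (g h : G)
    (a : A) : α g (α h a) = α (g * h) a := by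
  rw [map_mul, StarAlgEquiv.mul_apply]

variable {A G : Type*} [CStarAlgebra A] [Group G] [Fintype G] [DecidableEq G]

/-- The image of the crossed product in the regular representation. -/
def crossedProductSubalgebra (α : G →* (A ≃⋆ₐ[ℂ] A)) : StarSubalgebra ℂ (CStarMatrix G G A) where
  carrier := {M | ∃ x : G → A, ∀ g h, M g h = α g⁻¹ (x (g * h⁻¹))}
  mul_mem' := by
    rintro M M' ⟨x, hx⟩ ⟨y, hy⟩
    refine ⟨fun s => ∑ t, x t * α t (y (t⁻¹ * s)), fun g h => ?_⟩
    rw [CStarMatrix.mul_apply, map_sum]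
    refine Fintype.sum_equiv ((Equiv.inv G).trans (Equiv.mulLeft g)) _ _ fun k => ?_
    simp only [Equiv.trans_apply, Equiv.inv_apply, Equiv.coe_mulLeft, hx, hy]
    rw [map_mul (α g⁻¹), act_act]
    congr 3 <;> group
  add_mem' := by
    rintro M M' ⟨x, hx⟩ ⟨y, hy⟩
    exact ⟨x + y, fun g h => by simp [CStarMatrix.add_apply, hx, hy]⟩
  algebraMap_mem' := by
    intro c
    refine ⟨fun s => if s = 1 then algebraMap ℂ A c else 0, fun g h => ?_⟩
    rw [CStarMatrix.algebraMap_apply]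
    by_cases hgh : g = h
    · simp only [hgh, mul_inv_cancel, if_true, AlgHomClass.commutes]
    · have : g * h⁻¹ ≠ 1 := by rwa [Ne, mul_inv_eq_one]
      simp only [hgh, this, if_false, map_zero]
  star_mem' := by
    rintro M ⟨x, hx⟩
    refine ⟨fun s => α s (star (x s⁻¹)), fun g h => ?_⟩
    rw [CStarMatrix.star_apply, hx, act_act, ← map_star]
    congr 3 <;> group

/-- The crossed product `C⋆(G, A, α)`. -/
def CrossedProduct (α : G →* (A ≃⋆ₐ[ℂ] A)) : Type _ := crossedProductSubalgebra α

namespace CrossedProduct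

theorem isClosed_crossedProductSubalgebra [PartialOrder A] [StarOrderedRing A]
    (α : G →* (A ≃⋆ₐ[ℂ] A)) :
    IsClosed (crossedProductSubalgebra α : Set (CStarMatrix G G A)) := by
  have key : (crossedProductSubalgebra α : Set (CStarMatrix G G A)) =
      ⋂ (g : G) (h : G), {M | M g h = α g⁻¹ (α (g * h⁻¹) (M (g * h⁻¹) 1))} := by
    ext M
    simp only [Set.mem_iInter, Set.mem_ofPred_eq, SetLike.mem_coe]
    constructor
    · rintro ⟨x, hx⟩ g h
      rw [hx, hx (g * h⁻¹) 1, act_act, act_act]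
      congr 2
      · group
      · simp
    · intro hM
      exact ⟨fun s => α s (M s 1), hM⟩
  have hα : ∀ g, Continuous (α g) := fun g =>
    (NonUnitalStarAlgHom.isometry (α g) (EquivLike.injective (α g))).continuous
  have hev : ∀ g h : G, Continuous fun M : CStarMatrix G G A => M g h := fun g h =>
    (continuous_apply h).comp (continuous_apply (A := fun _ : G => G → A) g)
  rw [key]
  exact isClosed_iInter fun g => isClosed_iInter fun h =>
    isClosed_eq (hev _ _) ((hα _).comp ((hα _).comp (hev _ _)))

instance (α : G →* (A ≃⋆ₐ[ℂ] A)) : Ring (CrossedProduct α) :=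
  inferInstanceAs (Ring (crossedProductSubalgebra α))

instance (α : G →* (A ≃⋆ₐ[ℂ] A)) : StarRing (CrossedProduct α) :=
  inferInstanceAs (StarRing (crossedProductSubalgebra α))

instance (α : G →* (A ≃⋆ₐ[ℂ] A)) : Algebra ℂ (CrossedProduct α) :=
  inferInstanceAs (Algebra ℂ (crossedProductSubalgebra α))

instance [PartialOrder A] [StarOrderedRing A] (α : G →* (A ≃⋆ₐ[ℂ] A)) :
    CStarAlgebra (CrossedProduct α) :=
  letI := isClosed_crossedProductSubalgebra α
  inferInstanceAs (CStarAlgebra (crossedProductSubalgebra α))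

/-- The usual order: `0 ≤ z` iff `z` is selfadjoint with nonnegative spectrum in the crossed
product. -/
instance [PartialOrder A] [StarOrderedRing A] (α : G →* (A ≃⋆ₐ[ℂ] A)) :
    PartialOrder (CrossedProduct α) :=
  CStarAlgebra.spectralOrder _

instance [PartialOrder A] [StarOrderedRing A] (α : G →* (A ≃⋆ₐ[ℂ] A)) :
    StarOrderedRing (CrossedProduct α) :=
  CStarAlgebra.spectralOrderedRing _

variable (α : G →* (A ≃⋆ₐ[ℂ] A))

/-- The element `∑ s, x s • u s` of the crossed product with coefficients `x : G → A`. -/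
def ofCoeff (x : G → A) : CrossedProduct α :=
  ⟨CStarMatrix.ofMatrix fun g h => α g⁻¹ (x (g * h⁻¹)), x, fun _ _ => rfl⟩

variable {α} in
theorem ofCoeff_injective : Function.Injective (ofCoeff α) := by
  intro x y h
  funext s
  have h1 : α s⁻¹ (x (s * 1⁻¹)) = α s⁻¹ (y (s * 1⁻¹)) :=
    congrFun (congrFun (congrArg Subtype.val h) s) 1
  simpa using h1

variable {α} in
theorem ofCoeff_surjective : Function.Surjective (ofCoeff α) := by
  rintro ⟨M, x, hx⟩
  exact ⟨x, Subtype.ext (CStarMatrix.ext fun g h => (hx g h).symm)⟩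

theorem ofCoeff_add (x y : G → A) : ofCoeff α (x + y) = ofCoeff α x + ofCoeff α y :=
  Subtype.ext (CStarMatrix.ext fun g h => map_add (α g⁻¹) (x (g * h⁻¹)) (y (g * h⁻¹)))

theorem ofCoeff_smul (c : ℂ) (x : G → A) : ofCoeff α (c • x) = c • ofCoeff α x :=
  Subtype.ext (CStarMatrix.ext fun g h => map_smul (α g⁻¹) c (x (g * h⁻¹)))

theorem ofCoeff_mul (x y : G → A) :
    ofCoeff α x * ofCoeff α y = ofCoeff α fun s => ∑ t, x t * α t (y (t⁻¹ * s)) := by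
  refine Subtype.ext (CStarMatrix.ext fun g h => ?_)
  change ((ofCoeff α x).1 * (ofCoeff α y).1) g h = α g⁻¹ (∑ t, x t * α t (y (t⁻¹ * (g * h⁻¹))))
  rw [CStarMatrix.mul_apply, map_sum]
  refine Fintype.sum_equiv ((Equiv.inv G).trans (Equiv.mulLeft g)) _ _ fun k => ?_
  change α g⁻¹ (x (g * k⁻¹)) * α k⁻¹ (y (k * h⁻¹)) = α g⁻¹ (x (g * k⁻¹) * _)
  rw [map_mul (α g⁻¹), act_act]
  congr 3
  · simp
  · simp [mul_assoc]

theorem star_ofCoeff (x : G → A) :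
    star (ofCoeff α x) = ofCoeff α fun s => α s (star (x s⁻¹)) := by
  refine Subtype.ext (CStarMatrix.ext fun g h => ?_)
  change star (α h⁻¹ (x (h * g⁻¹))) = α g⁻¹ (α (g * h⁻¹) (star (x (g * h⁻¹)⁻¹)))
  rw [act_act, ← map_star]
  congr 3 <;> simp

theorem ofCoeff_one : ofCoeff α (Pi.single 1 1) = 1 := by
  refine Subtype.ext (CStarMatrix.ext fun g h => ?_)
  change α g⁻¹ (Pi.single (M := fun _ : G => A) 1 1 (g * h⁻¹)) = (1 : CStarMatrix G G A) g h
  rw [CStarMatrix.one_apply]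
  by_cases hgh : g = h
  · subst hgh; simp
  · have : g * h⁻¹ ≠ 1 := by rwa [Ne, mul_inv_eq_one]
    simp [hgh, this]

/-- The canonical unitary `u s` of the crossed product implementing `α s`. -/
def u (s : G) : CrossedProduct α := ofCoeff α (Pi.single s 1)

/-- The inclusion `ι : A → C⋆(G, A, α)`, `a ↦ a • u 1`. -/
def incl : A →⋆ₐ[ℂ] CrossedProduct α where
  toFun a := ofCoeff α (Pi.single 1 a)
  map_one' := ofCoeff_one α
  map_mul' a b := by
    rw [ofCoeff_mul]
    congr 1
    funext s
    rw [Finset.sum_eq_single 1 (fun t _ ht => by simp [ht]) (by simp)]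
    by_cases hs : s = 1
    · subst hs; simp
    · simp [hs]
  map_zero' := by
    rw [Pi.single_zero]
    simpa using ofCoeff_smul α 0 0
  map_add' a b := by rw [Pi.single_add, ofCoeff_add]
  commutes' c := by
    rw [Algebra.algebraMap_eq_smul_one, Algebra.algebraMap_eq_smul_one, ← ofCoeff_one α,
      ← ofCoeff_smul, Pi.single_smul]
  map_star' a := by
    rw [star_ofCoeff]
    congr 1
    funext s
    by_cases hs : s = 1
    · subst hs; simp
    · simp [hs]

theorem incl_mul_ofCoeff (a : A) (x : G → A) :
    incl α a * ofCoeff α x = ofCoeff α fun s => a * x s := by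
  change ofCoeff α (Pi.single 1 a) * _ = _
  rw [ofCoeff_mul]
  congr 1
  funext s
  rw [Finset.sum_eq_single 1 (fun t _ ht => by simp [ht]) (by simp)]
  simp

theorem incl_mul_u (a : A) (s : G) : incl α a * u α s = ofCoeff α (Pi.single s a) := by
  rw [u, incl_mul_ofCoeff]
  congr 1
  funext t
  by_cases h : t = s
  · subst h; simp
  · simp [h]

theorem u_mul (s t : G) : u α s * u α t = u α (s * t) := by
  simp only [u, ofCoeff_mul]
  congr 1
  funext r
  rw [Finset.sum_eq_single s (fun k _ hk => by simp [hk]) (by simp)]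
  by_cases h : r = s * t
  · subst h; simp
  · have : s⁻¹ * r ≠ t := fun h' => h (by rw [← h']; group)
    simp [h, this]

theorem u_one : u α 1 = 1 := ofCoeff_one α

theorem star_u (s : G) : star (u α s) = u α s⁻¹ := by
  rw [u, star_ofCoeff, u]
  congr 1
  funext r
  by_cases h : r = s⁻¹
  · subst h; simp
  · have : r⁻¹ ≠ s := fun h' => h (by rw [← h', inv_inv])
    simp [h, this]

/-- Covariance: `u s` implements `α s`. -/
theorem u_mul_incl_mul_star_u (s : G) (a : A) :
    u α s * incl α a * star (u α s) = incl α (α s a) := by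
  have h : u α s * incl α a = incl α (α s a) * u α s := by
    rw [incl_mul_u]
    change ofCoeff α (Pi.single s 1) * ofCoeff α (Pi.single 1 a) = _
    rw [ofCoeff_mul]
    congr 1
    funext r
    rw [Finset.sum_eq_single s (fun k _ hk => by simp [hk]) (by simp)]
    by_cases h : r = s
    · subst h; simp
    · have : s⁻¹ * r ≠ 1 := fun h' => h (inv_mul_eq_one.mp h').symm
      simp [h, this]
  rw [h, star_u, mul_assoc, u_mul, mul_inv_cancel, u_one, mul_one]

theorem ofCoeff_eq_sum (x : G → A) : ofCoeff α x = ∑ s, incl α (x s) * u α s := by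
  let L : (G → A) →+ CrossedProduct α :=
    { toFun := ofCoeff α
      map_zero' := by simpa using ofCoeff_smul α 0 0
      map_add' := ofCoeff_add α }
  have h : L x = ∑ s, L (Pi.single s (x s)) := by
    rw [← map_sum, Finset.univ_sum_single]
  refine h.trans (Finset.sum_congr rfl fun s _ => (incl_mul_u α (x s) s).symm)

/-- The universal property of the (full) crossed product: every covariant representation of
`(A, G, α)` integrates to a unique ⋆-homomorphism. -/
theorem existsUnique_lift {C : Type*} [CStarAlgebra C] (π : A →⋆ₐ[ℂ] C) (v : G →* unitary C)
    (hcov : ∀ s a, (v s : C) * π a * star (v s : C) = π (α s a)) :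
    ∃! φ : CrossedProduct α →⋆ₐ[ℂ] C, (∀ a, φ (incl α a) = π a) ∧ ∀ s, φ (u α s) = v s := by
  obtain ⟨c, hc⟩ : ∃ c : CrossedProduct α → G → A, ∀ b, ofCoeff α (c b) = b :=
    ⟨_, fun b => (ofCoeff_surjective b).choose_spec⟩
  have hc' : ∀ x, c (ofCoeff α x) = x := fun x => ofCoeff_injective (hc _)
  let I : (G → A) → C := fun x => ∑ s, π (x s) * v s
  have hcov' : ∀ s a, (v s : C) * π a = π (α s a) * v s := fun s a => by
    rw [← hcov, mul_assoc, Unitary.coe_star_mul_self, mul_one]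
  have hsingle : ∀ s a, I (Pi.single s a) = π a * v s := fun s a => by
    change ∑ t, π (Pi.single (M := fun _ : G => A) s a t) * (v t : C) = _
    rw [Finset.sum_eq_single s (fun t _ ht => by simp [ht]) (by simp)]
    simp
  have hsmul : ∀ (r : ℂ) x, I (r • x) = r • I x := fun r x => by
    simp [I, Finset.smul_sum, map_smul]
  have hmul : ∀ x y, I (fun s => ∑ t, x t * α t (y (t⁻¹ * s))) = I x * I y := fun x y => by
    simp only [I, map_sum, map_mul, Finset.sum_mul]
    rw [Finset.sum_comm]
    refine Finset.sum_congr rfl fun t _ => ?_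
    rw [Finset.mul_sum]
    refine Fintype.sum_equiv (Equiv.mulLeft t⁻¹) _ _ fun s => ?_
    have hv : (v s : C) = v t * v (t⁻¹ * s) := by
      rw [← Submonoid.coe_mul, ← map_mul]; simp
    rw [hv, Equiv.coe_mulLeft, mul_assoc, ← mul_assoc (π _) (v t : C), ← hcov']
    simp only [mul_assoc]
  have hstar : ∀ x, I (fun s => α s (star (x s⁻¹))) = star (I x) := fun x => by
    simp only [I, star_sum, star_mul]
    refine Fintype.sum_equiv (Equiv.inv G) _ _ fun s => ?_
    rw [← hcov', Equiv.inv_apply, map_star, map_inv, ← Unitary.star_eq_inv, Unitary.coe_star,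
      star_star]
  have hone : I (Pi.single 1 1) = 1 := by rw [hsingle]; simp
  let φ : CrossedProduct α →⋆ₐ[ℂ] C :=
    { toFun := fun b => I (c b)
      map_one' := by rw [← ofCoeff_one α, hc', hone]
      map_mul' := fun a b => by
        rw [← hmul]
        congr 1
        apply ofCoeff_injective
        rw [← ofCoeff_mul, hc, hc, hc]
      map_zero' := by
        have : c (0 : CrossedProduct α) = (0 : ℂ) • (0 : G → A) := by
          apply ofCoeff_injective
          rw [hc, ofCoeff_smul, zero_smul]
        rw [this, hsmul, zero_smul]
      map_add' := fun a b => by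
        have : c (a + b) = c a + c b := by
          apply ofCoeff_injective
          rw [ofCoeff_add, hc, hc, hc]
        simp only [this, I, Pi.add_apply, map_add, add_mul, Finset.sum_add_distrib]
      commutes' := fun r => by
        have : c (algebraMap ℂ (CrossedProduct α) r) = r • Pi.single 1 1 := by
          apply ofCoeff_injective
          rw [hc, ofCoeff_smul, ofCoeff_one, Algebra.algebraMap_eq_smul_one]
        rw [this, hsmul, hone, Algebra.algebraMap_eq_smul_one]
      map_star' := fun b => by
        rw [← hstar]
        congr 1
        apply ofCoeff_injective
        rw [← star_ofCoeff, hc, hc] }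
  refine ⟨φ, ⟨fun a => ?_, fun s => ?_⟩, fun ψ hψ => ?_⟩
  · change I (c (ofCoeff α (Pi.single 1 a))) = _
    rw [hc', hsingle]; simp
  · change I (c (ofCoeff α (Pi.single s 1))) = _
    rw [hc', hsingle]; simp
  · refine StarAlgHom.ext fun b => ?_
    change ψ b = ∑ s, π (c b s) * v s
    conv_lhs => rw [← hc b, ofCoeff_eq_sum, map_sum]
    exact Finset.sum_congr rfl fun s _ => by rw [map_mul, hψ.1, hψ.2]

end CrossedProduct

end CrossedProduct

end

/-! ### Murray–von Neumann calculus of projections. -/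

section Projections

variable {A : Type*} [CStarAlgebra A]

/-! The Rokhlin projections `E g` are nearly permuted by the action, so `α g⁻¹ (E g)` is close to `E
1` and a partial isometry `w g` near `E 1` joins them (`exists_partialIsometries`). In the crossed
product `v g = u g (w g)⋆` then satisfies `v g⋆ v g = E 1` and `v g v g⋆ = E g` exactly. With `f = E
1` and `e = ∑ E g`, the map `e_{g,h} ⊗ a ↦ v g a v h⋆` is an isomorphism of `M_n ⊗ fAf` onto an
algebra `D` with unit `e`. Since `v g` is close to `u g f`, the diagonal blocks are close to `α g
a`. As `E g` almost commutes with the coefficients of `a ∈ F`, and `E g u h` is close to `v g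
v_{h⁻¹g}⋆`, the product `e a` is close to `D` (`norm_incl_sum_mul_sub_le`).

The smallness of `1 - e` is arranged beforehand. The conditional expectation of `z` is nonzero, and
compressing `z` by a suitable Rokhlin projection nearly reduces it to this coefficient; real rank
zero of `A` then supplies a nonzero projection `P ∈ A` dominated by `z`
(`exists_projection_of_nonneg`). Simplicity, infinite dimension and real rank zero allow repeated
halving, which gives a nonzero `q` subequivalent to `P` with all traces below `2^{-(N+1)}`
(`exists_small_projection`). Using `q` as the positive element in the Rokhlin property makes `1 - e`
subequivalent to `q`, hence to `P`.

For the `N` copies of `1 - e`, comparison by traces finds each one under what is left of `e`. Such a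
copy need not lie in `D`; Riesz decomposition replaces it by an equivalent sum of subprojections of
the `E g`, and block diagonal elements of `A` do lie in `D` (`exists_diagonal_copies`). -/

theorem MvNEquiv.trans {p q r : A} (hp : IsStarProjection p) (hr : IsStarProjection r)
    (h₁ : MvNEquiv p q) (h₂ : MvNEquiv q r) : MvNEquiv p r := by
  obtain ⟨v, rfl, rfl⟩ := h₁
  obtain ⟨w, hw, rfl⟩ := h₂
  refine ⟨w * v, ?_, ?_⟩
  · calc star (w * v) * (w * v) = star v * (star w * w) * v := by simp only [star_mul, mul_assoc]
      _ = (star v * v) * (star v * v) := by rw [hw]; simp only [mul_assoc]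
      _ = star v * v := hp.isIdempotentElem
  · calc w * v * star (w * v) = w * (v * star v) * star w := by simp only [star_mul, mul_assoc]
      _ = (w * star w) * (w * star w) := by rw [← hw]; simp only [mul_assoc]
      _ = w * star w := hr.isIdempotentElem

theorem MvNEquiv.symm {p q : A} (h : MvNEquiv p q) : MvNEquiv q p := by
  obtain ⟨v, h₁, h₂⟩ := h
  exact ⟨star v, by rwa [star_star], by rwa [star_star]⟩

theorem MvNEquiv.refl {p : A} (hp : IsStarProjection p) : MvNEquiv p p :=
  ⟨p, by rw [hp.isSelfAdjoint.star_eq, hp.isIdempotentElem.eq],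
    by rw [hp.isSelfAdjoint.star_eq, hp.isIdempotentElem.eq]⟩

theorem IsStarProjection.mul_eq_comm {p q : A} (hp : IsStarProjection p) (hq : IsStarProjection q) :
    p * q = q ↔ q * p = q := by
  rw [← star_inj (x := p * q), star_mul, hp.isSelfAdjoint.star_eq, hq.isSelfAdjoint.star_eq]

theorem IsStarProjection.mul_eq_zero_comm {p q : A} (hp : IsStarProjection p)
    (hq : IsStarProjection q) : p * q = 0 ↔ q * p = 0 := by
  rw [← star_eq_zero (x := p * q), star_mul, hp.isSelfAdjoint.star_eq, hq.isSelfAdjoint.star_eq]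

/-- The element `v (1 - p)` vanishes by the C⋆-identity, because `(1 - p) v⋆v (1 - p) = 0`. -/
theorem mul_eq_self_of_star_mul_self {v p : A} (hp : IsStarProjection p) (h : star v * v = p) :
    v * p = v := by
  have : v * (1 - p) = 0 := by
    rw [← CStarRing.star_mul_self_eq_zero_iff, star_mul, mul_assoc, ← mul_assoc (star v), h,
      hp.mul_one_sub_self, mul_zero]
  rw [mul_sub, mul_one, sub_eq_zero] at this
  exact this.symm

theorem mul_eq_self_of_mul_star_self {v q : A} (hq : IsStarProjection q) (h : v * star v = q) :
    q * v = v := by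
  have := mul_eq_self_of_star_mul_self (v := star v) hq (by rwa [star_star])
  rw [← star_inj, star_mul, hq.isSelfAdjoint.star_eq, this]

theorem isStarProjection_mul_star {v p : A} (hp : IsStarProjection p) (h : star v * v = p) :
    IsStarProjection (v * star v) where
  isIdempotentElem := by
    have := mul_eq_self_of_star_mul_self hp h
    calc v * star v * (v * star v) = v * (star v * v) * star v := by simp only [mul_assoc]
      _ = v * star v := by rw [h, this]
  isSelfAdjoint := IsSelfAdjoint.mul_star_self v

theorem IsStarProjection.norm_le_one' {p : A} (hp : IsStarProjection p) : ‖p‖ ≤ 1 := by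
  have h : ‖p‖ = ‖p‖ * ‖p‖ := by
    conv_lhs => rw [← hp.isIdempotentElem.eq]
    conv_lhs => enter [1, 1]; rw [← hp.isSelfAdjoint.star_eq]
    exact CStarRing.norm_star_mul_self
  nlinarith [norm_nonneg p]

theorem MvNSubequiv.trans {p q r : A} (hp : IsStarProjection p)
    (h₁ : MvNSubequiv p q) (h₂ : MvNSubequiv q r) : MvNSubequiv p r := by
  obtain ⟨s, hs, hqs, v, hv, rfl⟩ := h₁
  obtain ⟨t, ht, hrt, w, hw, rfl⟩ := h₂
  have e : star (w * (v * star v)) * (w * (v * star v)) = v * star v := by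
    calc _ = v * star v * (star w * w) * (v * star v) := by simp only [star_mul, star_star, mul_assoc]
      _ = v * star v := by rw [hw, mul_assoc, hqs, hs.isIdempotentElem.eq]
  have hproj := isStarProjection_mul_star hs e
  refine ⟨_, hproj, ?_, MvNEquiv.trans hp hproj ⟨v, hv, rfl⟩ ⟨_, e, rfl⟩⟩
  have : r * w = w := by
    conv_lhs => rw [← mul_eq_self_of_mul_star_self ht rfl, ← mul_assoc, hrt,
      mul_eq_self_of_mul_star_self ht rfl]
  simp only [← mul_assoc, this]

theorem MvNEquiv.add {p₁ p₂ q₁ q₂ : A} (hp₁ : IsStarProjection p₁) (hp₂ : IsStarProjection p₂)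
    (hq₁ : IsStarProjection q₁) (hq₂ : IsStarProjection q₂) (hp : p₁ * p₂ = 0) (hq : q₁ * q₂ = 0)
    (h₁ : MvNEquiv p₁ q₁) (h₂ : MvNEquiv p₂ q₂) : MvNEquiv (p₁ + p₂) (q₁ + q₂) := by
  obtain ⟨v, hv, hv'⟩ := h₁
  obtain ⟨w, hw, hw'⟩ := h₂
  have e₁ : star v * w = 0 := by
    have a := mul_eq_self_of_mul_star_self hq₁ hv'
    have b := mul_eq_self_of_mul_star_self hq₂ hw'
    rw [← a, ← b, star_mul, hq₁.isSelfAdjoint.star_eq, mul_assoc, ← mul_assoc q₁, hq, zero_mul,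
      mul_zero]
  have e₂ : v * star w = 0 := by
    have a := mul_eq_self_of_star_mul_self hp₁ hv
    have b := mul_eq_self_of_star_mul_self hp₂ hw
    rw [← a, ← b, star_mul, hp₂.isSelfAdjoint.star_eq, mul_assoc, ← mul_assoc p₁, hp, zero_mul,
      mul_zero]
  have e₃ : star w * v = 0 := by rw [← star_inj, star_mul, star_star, e₁, star_zero]
  have e₄ : w * star v = 0 := by rw [← star_inj, star_mul, star_star, e₂, star_zero]
  exact ⟨v + w, by rw [star_add, add_mul, mul_add, mul_add, hv, hw, e₁, e₃]; abel,
    by rw [star_add, add_mul, mul_add, mul_add, hv', hw', e₂, e₄]; abel⟩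

theorem IsStarProjection.finset_sum {ι : Type*} (s : Finset ι) {e : ι → A}
    (he : ∀ i ∈ s, IsStarProjection (e i)) (hd : ∀ i ∈ s, ∀ j ∈ s, i ≠ j → e i * e j = 0) :
    IsStarProjection (∑ i ∈ s, e i) where
  isIdempotentElem := by
    rw [IsIdempotentElem, Finset.sum_mul]
    refine Finset.sum_congr rfl fun i hi => ?_
    rw [Finset.mul_sum, Finset.sum_eq_single i (fun j hj h => hd i hi j hj h.symm)
      (fun h => absurd hi h), (he i hi).isIdempotentElem.eq]
  isSelfAdjoint := by
    rw [IsSelfAdjoint, star_sum]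
    exact Finset.sum_congr rfl fun i hi => (he i hi).isSelfAdjoint.star_eq

end Projections

/-! ### Order estimates and comparison of projections. -/

section Order

variable {A : Type*} [CStarAlgebra A] [PartialOrder A] [StarOrderedRing A]

theorem IsStarProjection.real_smul_nonneg {p : A} (hp : IsStarProjection p) {c : ℝ} (hc : 0 ≤ c) :
    0 ≤ c • p := smul_nonneg hc hp.nonneg

theorem IsStarProjection.conj_mono {p a b : A} (hp : IsStarProjection p) (h : a ≤ b) :
    p * a * p ≤ p * b * p := by
  simpa [hp.isSelfAdjoint.star_eq] using star_left_conjugate_le_conjugate h p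

theorem le_norm_smul_one {a : A} (ha : IsSelfAdjoint a) : a ≤ ‖a‖ • (1 : A) := by
  simpa [Algebra.algebraMap_eq_smul_one] using ha.le_algebraMap_norm_self

theorem neg_norm_smul_one_le {a : A} (ha : IsSelfAdjoint a) : -(‖a‖ • (1 : A)) ≤ a := by
  simpa [Algebra.algebraMap_eq_smul_one] using ha.neg_algebraMap_norm_le_self

theorem le_smul_one {a : A} (ha : IsSelfAdjoint a) {c : ℝ} (h : ‖a‖ ≤ c) : a ≤ c • (1 : A) :=
  (le_norm_smul_one ha).trans (smul_le_smul_of_nonneg_right h zero_le_one)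

theorem neg_smul_one_le {a : A} (ha : IsSelfAdjoint a) {c : ℝ} (h : ‖a‖ ≤ c) :
    -(c • (1 : A)) ≤ a :=
  (neg_le_neg (smul_le_smul_of_nonneg_right h zero_le_one)).trans (neg_norm_smul_one_le ha)

/-- If `b⋆b` is bounded below on the projection `p`, then `p` is the initial projection of a
partial isometry of the form `b y`. -/
theorem exists_star_mul_self_eq_of_smul_le {p b : A} (hp : IsStarProjection p) (hbp : b * p = b)
    {κ : ℝ} (hκ : 0 < κ) (h : κ • p ≤ star b * b) :
    ∃ y, y * p = y ∧ star (b * y) * (b * y) = p := by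
  -- Adding `1 - p` makes `b⋆b` invertible in `A` while keeping it commuting with `p`; the witness
  -- is `y = k^(-1/2) p`.
  set k := star b * b + (1 - p) with hk
  have hsp : IsStrictlyPositive k := by
    have h1 : IsStrictlyPositive ((min κ 1) • (1 : A)) :=
      IsStrictlyPositive.smul (lt_min hκ one_pos) isStrictlyPositive_one
    refine h1.of_le ?_
    have h2 : (min κ 1) • p ≤ κ • p := smul_le_smul_of_nonneg_right (min_le_left _ _) hp.nonneg
    have h3 : (min κ 1) • (1 - p) ≤ (1 : ℝ) • (1 - p) :=
      smul_le_smul_of_nonneg_right (min_le_right _ _) hp.one_sub.nonneg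
    calc (min κ 1) • (1 : A) = (min κ 1) • p + (min κ 1) • (1 - p) := by rw [← smul_add]; simp
      _ ≤ star b * b + (1 - p) := add_le_add (h2.trans h) (by simpa using h3)
  have hpb : p * star b = star b := by
    rw [← star_inj, star_mul, star_star, hp.isSelfAdjoint.star_eq, hbp]
  have hkp : k * p = star b * b := by
    rw [hk, add_mul, mul_assoc, hbp, hp.one_sub_mul_self, add_zero]
  have hpk : p * k = star b * b := by
    rw [hk, mul_add, ← mul_assoc, hpb, hp.mul_one_sub_self, add_zero]
  set r := k ^ (-(1 / 2) : ℝ) with hr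
  have hrk : r * k * r = 1 := CFC.conjugate_rpow_neg_one_half k
  have hrp : Commute r p := by
    have : Commute k p := hkp.trans hpk.symm
    exact this.cfc_nnreal _
  have hrs : star r = r := (IsSelfAdjoint.of_nonneg CFC.rpow_nonneg).star_eq
  refine ⟨r * p, by rw [mul_assoc, hp.isIdempotentElem.eq], ?_⟩
  calc star (b * (r * p)) * (b * (r * p)) = p * r * (star b * b) * (r * p) := by
        simp only [star_mul, hrs, hp.isSelfAdjoint.star_eq, mul_assoc]
    _ = p * r * k * (p * r) * p := by rw [← hkp]; simp only [mul_assoc]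
    _ = p * r * k * (r * p) * p := by rw [hrp.eq]
    _ = p * (r * k * r) * (p * p) := by simp only [mul_assoc]
    _ = p := by rw [hrk, mul_one, hp.isIdempotentElem.eq, hp.isIdempotentElem.eq]

/-- With `b = q p`, `b⋆b = p q p` is bounded below on `p`, so some `b y` is a partial isometry with
initial projection `p`; its range lies under `q`. -/
theorem mvNSubequiv_of_smul_le {p q : A} (hp : IsStarProjection p) (hq : IsStarProjection q)
    {κ : ℝ} (hκ : 0 < κ) (h : κ • p ≤ p * q * p) : MvNSubequiv p q := by
  obtain ⟨y, -, hy⟩ := exists_star_mul_self_eq_of_smul_le (b := q * p) hp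
    (by rw [mul_assoc, hp.isIdempotentElem.eq]) hκ (by
      rw [star_mul, hp.isSelfAdjoint.star_eq, hq.isSelfAdjoint.star_eq, mul_assoc, ← mul_assoc q,
        hq.isIdempotentElem.eq, ← mul_assoc]
      exact h)
  exact ⟨_, isStarProjection_mul_star hp hy, by simp only [← mul_assoc, hq.isIdempotentElem.eq],
    _, hy, rfl⟩

end Order

/-! ### Real rank zero passes to corners. -/

section RealRankZeroCorner

variable {A : Type*} [CStarAlgebra A]

/-- Approximate `a + (1 - p)` by an invertible selfadjoint `b₀`. Its `(1 - p)`-block is close to `1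
- p`, hence invertible, and the Schur complement of that block is an invertible selfadjoint element
of the corner. It differs from the `p`-block of `b₀` only by a term quadratic in the error. -/
theorem HasRealRankZero.exists_isUnit_corner (hrr : HasRealRankZero A) {p a : A}
    (hp : IsStarProjection p) (ha : IsSelfAdjoint a) (hpa : p * a * p = a) {ε : ℝ} (hε : 0 < ε) :
    ∃ b, IsSelfAdjoint b ∧ p * b * p = b ∧ IsUnit (b + (1 - p)) ∧ ‖a - b‖ < ε := by
  obtain ⟨c, hc⟩ : ∃ c, c = 1 - p := ⟨_, rfl⟩
  rw [← hc]
  have hcp : IsStarProjection c := hc ▸ hp.one_sub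
  have cc : c * c = c := hcp.isIdempotentElem
  have pp : p * p = p := hp.isIdempotentElem
  have pc : p * c = 0 := hc ▸ hp.mul_one_sub_self
  have cp : c * p = 0 := hc ▸ hp.one_sub_mul_self
  have sp : star p = p := hp.isSelfAdjoint
  have sc : star c = c := hcp.isSelfAdjoint
  have p1 := hp.norm_le_one'
  have c1 := hcp.norm_le_one'
  have pca : p + c = 1 := by rw [hc]; abel
  -- The bound `1/4` gives `‖k‖ ≤ 2` for the inverse `k` below; the final error is at most `δ + 2δ²
  -- ≤ 3δ/2`, which is below `ε`.
  set δ := min (ε / 2) (1 / 4) with hδ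
  have hδ0 : 0 < δ := lt_min (by positivity) (by norm_num)
  have hδ1 : δ ≤ 1 / 4 := min_le_right _ _
  have hδ2 : δ ≤ ε / 2 := min_le_left _ _
  obtain ⟨b₀, hb₀, hbu, hab⟩ := hrr (a + c) (ha.add hcp.isSelfAdjoint) δ hδ0
  have sb : star b₀ = b₀ := hb₀
  have hcompr : ∀ x y : A, ‖x‖ ≤ 1 → ‖y‖ ≤ 1 → ‖x * (a + c - b₀) * y‖ < δ := by
    intro x y hx hy
    refine lt_of_le_of_lt ?_ hab
    calc ‖x * (a + c - b₀) * y‖ ≤ ‖x‖ * ‖a + c - b₀‖ * ‖y‖ := norm_mul₃_le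
      _ ≤ 1 * ‖a + c - b₀‖ * 1 := by gcongr
      _ = _ := by ring
  have ca : c * a = 0 := by rw [← hpa, ← mul_assoc, ← mul_assoc, cp, zero_mul, zero_mul]
  have ac : a * c = 0 := by rw [← hpa, mul_assoc, pc, mul_zero]
  set d := p * b₀ * c with hd
  have hdn : ‖d‖ ≤ δ := by
    have : d = -(p * (a + c - b₀) * c) := by
      rw [mul_sub, sub_mul, mul_add, add_mul, mul_assoc p a c, ac, mul_assoc p c c, cc, pc, hd]
      simp
    rw [this, norm_neg]
    exact (hcompr p c p1 c1).le
  have sd : star d = c * b₀ * p := by simp only [hd, star_mul, sp, sc, sb, mul_assoc]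
  -- Filling the other corner with `p` lets the `c`-block be inverted inside `A`.
  set m := c * b₀ * c + p with hm
  have hm1 : ‖1 - m‖ < δ := by
    have : 1 - m = c * (a + c - b₀) * c := by
      rw [mul_sub, sub_mul, mul_add, add_mul, ca, zero_mul, cc, cc, hm, ← pca]
      abel
    rw [this]
    exact hcompr c c c1 c1
  have hmu : IsUnit m := by
    have := (Units.oneSub (1 - m) (hm1.trans (by linarith))).isUnit
    simpa using this
  obtain ⟨k, hmk, hkm⟩ : ∃ k, m * k = 1 ∧ k * m = 1 :=
    ⟨hmu.unit⁻¹.1, hmu.mul_val_inv, hmu.val_inv_mul⟩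
  have sm : star m = m := by simp only [hm, star_add, star_mul, sp, sc, sb, mul_assoc]
  have sk : star k = k := by
    have : star k * m = 1 := by rw [← sm, ← star_mul, hmk, star_one]
    calc star k = star k * (m * k) := by rw [hmk, mul_one]
      _ = k := by rw [← mul_assoc, this, one_mul]
  have mp : m * p = p := by rw [hm, add_mul, mul_assoc, cp, mul_zero, zero_add, pp]
  have kp : k * p = p := by
    conv_lhs => rw [← mp]
    rw [← mul_assoc, hkm, one_mul]
  have pk : p * k = p := by rw [← star_inj, star_mul, sk, sp, kp]
  have kc : k * (c * b₀ * c) = c := by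
    have : k * (c * b₀ * c) + k * p = 1 := by rw [← mul_add, ← hm, hkm]
    rw [kp] at this
    exact (eq_sub_of_add_eq this).trans hc.symm
  have ck : (c * b₀ * c) * k = c := by
    rw [← star_inj, star_mul, sk, sc]
    simp only [star_mul, sc, sb]
    simpa only [mul_assoc] using kc
  have hkn : ‖k‖ ≤ 2 := by
    have h1 : k = 1 + (1 - m) * k := by rw [sub_mul, hmk]; simp
    have h2 : ‖k‖ ≤ 1 + δ * ‖k‖ := by
      conv_lhs => rw [h1]
      refine (norm_add_le _ _).trans (add_le_add (IsStarProjection.one A).norm_le_one' ?_)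
      exact (norm_mul_le _ _).trans (by gcongr)
    nlinarith [norm_nonneg k]
  have pd : p * d = d := by rw [hd, ← mul_assoc, ← mul_assoc, pp]
  have dp : d * p = 0 := by rw [hd, mul_assoc, cp, mul_zero]
  have dc : d * c = d := by rw [hd, mul_assoc, cc]
  have sdp : star d * p = star d := by rw [sd, mul_assoc, pp]
  have psd : p * star d = 0 := by rw [sd, ← mul_assoc, ← mul_assoc, pc, zero_mul, zero_mul]
  have kd : k * d = d := by
    conv_lhs => rw [← pd]
    rw [← mul_assoc, kp, pd]
  have dd : d * d = 0 := by
    conv_lhs => rw [← pd, ← mul_assoc, mul_assoc p d p, dp, mul_zero, zero_mul]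
  have hsplit : p * b₀ * p + d + star d + c * b₀ * c = b₀ := by
    calc _ = (p + c) * b₀ * (p + c) := by
          rw [sd, hd, add_mul, add_mul, mul_add, mul_add]; abel
      _ = b₀ := by rw [pca, one_mul, mul_one]
  have kpc : c * k = k * c := by
    rw [hc, sub_mul, mul_sub, one_mul, mul_one, pk, kp]
  have dkb : d * k * b₀ = d * k * star d + d := by
    calc d * k * b₀ = d * (c * k) * b₀ := by rw [← mul_assoc, dc]
      _ = d * k * (c * b₀ * (p + c)) := by rw [kpc, pca, mul_one]; simp only [mul_assoc]
      _ = d * k * star d + d * (k * (c * b₀ * c)) := by rw [mul_add, mul_add, sd]; simp only [mul_assoc]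
      _ = _ := by rw [kc, dc]
  have bkd : b₀ * k * star d = d * k * star d + star d := by
    have := congrArg star dkb
    simpa only [star_mul, star_add, sk, sb, star_star, mul_assoc] using this
  -- The element `d k` squares to zero, so `1 - d k` is invertible; it is the elementary matrix that
  -- removes the off-diagonal blocks of `b₀`.
  have T1 : (1 - d * k) * (1 + d * k) = 1 := by
    have : d * k * (d * k) = 0 := by rw [← mul_assoc, mul_assoc d k d, kd, dd, zero_mul]
    rw [sub_mul, mul_add, mul_one, one_mul, mul_add, mul_one, this]; abel
  have T2 : (1 + d * k) * (1 - d * k) = 1 := by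
    have : d * k * (d * k) = 0 := by rw [← mul_assoc, mul_assoc d k d, kd, dd, zero_mul]
    rw [add_mul, mul_sub, mul_one, one_mul, mul_sub, mul_one, this]; abel
  have hT : IsUnit (1 - d * k) := ⟨⟨_, _, T1, T2⟩, rfl⟩
  set b := p * b₀ * p - d * k * star d with hb
  have hTb : (1 - d * k) * b₀ * star (1 - d * k) = b + c * b₀ * c := by
    have z1 : d * k * star d * (k * star d) = 0 := by
      have : star d * k * star d = 0 := by
        rw [← sdp, mul_assoc (star d) p k, pk, mul_assoc (star d), ← mul_assoc p, psd, zero_mul,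
          mul_zero]
      simp only [mul_assoc] at this ⊢
      rw [this]; simp
    have e1 : star (1 - d * k) = 1 - k * star d := by
      simp only [star_sub, star_one, star_mul, sk]
    rw [e1, sub_mul, one_mul, dkb, mul_sub, mul_one, sub_mul, add_mul, z1, ← mul_assoc, bkd, hb]
    conv_lhs => enter [1, 1]; rw [← hsplit]
    rw [← mul_assoc]
    abel
  have bk : b * k = b := by
    have : star d * k = star d := by
      rw [← star_inj, star_mul, star_star, sk, kd]
    rw [hb, sub_mul, mul_assoc _ p k, pk, mul_assoc _ (star d) k, this]
  refine ⟨b, ?_, ?_, ?_, ?_⟩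
  · rw [IsSelfAdjoint, hb]
    simp only [star_sub, star_mul, sp, sk, sb, star_star, mul_assoc]
  · rw [hb, mul_sub, sub_mul]
    congr 1
    · simp only [← mul_assoc, pp]; simp only [mul_assoc, pp]
    · simp only [← mul_assoc, pd]; simp only [mul_assoc, sdp]
  -- Right multiplication by `k` fixes `b` and turns the block `c b₀ c` into `c`.
  · have h1 : b + c = (1 - d * k) * b₀ * star (1 - d * k) * k := by
      rw [hTb, add_mul, bk, ck]
    rw [h1]
    exact ((hT.mul hbu).mul hT.star).mul ⟨⟨k, m, hkm, hmk⟩, rfl⟩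
  · have h1 : a - b = p * (a + c - b₀) * p + d * k * star d := by
      rw [mul_sub, sub_mul, mul_add, add_mul, hpa, pc, zero_mul, hb]; abel
    have h2 : ‖d * k * star d‖ ≤ δ * 2 * δ := by
      refine norm_mul₃_le.trans ?_
      rw [norm_star]
      gcongr
    rw [h1]
    refine lt_of_le_of_lt (norm_add_le _ _) ?_
    have := hcompr p p p1 p1
    nlinarith

end RealRankZeroCorner

/-! ### Projections adapted to selfadjoint elements. -/

section RealRankZero

variable {A : Type*} [CStarAlgebra A] [PartialOrder A] [StarOrderedRing A]

/-- The spectral projection of an invertible selfadjoint element for the positive half-line. -/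
theorem exists_spectral_projection {b : A} (hb : IsSelfAdjoint b) (hu : IsUnit b) :
    ∃ P : A, IsStarProjection P ∧ (∀ x, Commute b x → Commute P x) ∧ 0 ≤ P * b * P ∧
      (1 - P) * b * (1 - P) ≤ 0 := by
  have h0 : ∀ t ∈ spectrum ℝ b, t ≠ 0 := fun t ht h =>
    spectrum.zero_notMem ℝ hu (h ▸ ht)
  -- This is the indicator of the positive half-line, continuous on the spectrum because
  -- invertibility excludes `0`.
  let f : ℝ → ℝ := fun t => (1 + t * |t|⁻¹) / 2
  have hf : ContinuousOn f (spectrum ℝ b) := by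
    refine ContinuousOn.div_const (continuousOn_const.add (continuousOn_id.mul ?_)) _
    exact (continuous_abs.continuousOn).inv₀ fun t ht => abs_ne_zero.2 (h0 t ht)
  have hf1 : ∀ t ∈ spectrum ℝ b, (0 < t ∧ f t = 1) ∨ (t < 0 ∧ f t = 0) := by
    intro t ht
    rcases lt_or_gt_of_ne (h0 t ht) with h | h
    · right
      refine ⟨h, ?_⟩
      simp only [f]
      rw [abs_of_neg h, inv_neg, mul_neg, mul_inv_cancel₀ h.ne]
      norm_num
    · left
      refine ⟨h, ?_⟩
      simp only [f]
      rw [abs_of_pos h, mul_inv_cancel₀ h.ne']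
      norm_num
  have hP : cfc f b * b * cfc f b = cfc (fun t => f t * t * f t) b := by
    rw [cfc_mul (fun t => f t * t) f b (hf.mul continuousOn_id) hf,
      cfc_mul f (fun t => t) b hf continuousOn_id, cfc_id' ℝ b]
  have h1P : 1 - cfc f b = cfc (fun t => 1 - f t) b := by
    rw [cfc_sub (fun _ => (1 : ℝ)) f b continuousOn_const hf, cfc_const_one ℝ b]
  have hf' : ContinuousOn (fun t => 1 - f t) (spectrum ℝ b) := continuousOn_const.sub hf
  have hP' : (1 - cfc f b) * b * (1 - cfc f b) = cfc (fun t => (1 - f t) * t * (1 - f t)) b := by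
    rw [h1P, cfc_mul (fun t => (1 - f t) * t) (fun t => 1 - f t) b (hf'.mul continuousOn_id) hf',
      cfc_mul (fun t => 1 - f t) (fun t => t) b hf' continuousOn_id, cfc_id' ℝ b]
  refine ⟨cfc f b, ⟨?_, cfc_predicate f b⟩, fun x hx => hx.cfc_real f, ?_, ?_⟩
  · rw [IsIdempotentElem, ← cfc_mul f f b hf hf]
    refine cfc_congr fun t ht => ?_
    rcases hf1 t ht with ⟨-, h⟩ | ⟨-, h⟩ <;> simp [h]
  · rw [hP]
    refine cfc_nonneg fun t ht => ?_
    rcases hf1 t ht with ⟨h', h⟩ | ⟨-, h⟩ <;> simp [h]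
    exact h'.le
  · rw [hP']
    refine cfc_nonpos _ _ fun t ht => ?_
    rcases hf1 t ht with ⟨-, h⟩ | ⟨h', h⟩ <;> simp [h]
    exact h'.le

/-- In real rank zero every selfadjoint element of a corner is, up to `δ`, positive on a
subprojection and negative on its complement. -/
theorem HasRealRankZero.exists_projection (hrr : HasRealRankZero A) {p a : A}
    (hp : IsStarProjection p) (ha : IsSelfAdjoint a) (hpa : p * a * p = a) {δ : ℝ} (hδ : 0 < δ) :
    ∃ P, IsStarProjection P ∧ p * P = P ∧ -(δ • P) ≤ P * a * P ∧
      (p - P) * a * (p - P) ≤ δ • (p - P) := by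
  obtain ⟨b, hb, hpb, hbu, hab⟩ := hrr.exists_isUnit_corner hp ha hpa hδ
  have sab : IsSelfAdjoint (a - b) := ha.sub hb
  have pp : p * p = p := hp.isIdempotentElem
  have pb : p * b = b := by rw [← hpb, ← mul_assoc, ← mul_assoc, pp]
  have bp : b * p = b := by rw [← hpb, mul_assoc, pp]
  -- The element `b + (1 - p)` commutes with `p`, so its spectral projection does too and `Q p` is a
  -- projection of the corner.
  obtain ⟨Q, hQ, hQc, hQ1, hQ2⟩ := exists_spectral_projection (hb.add hp.one_sub.isSelfAdjoint) hbu
  have hcomm : Commute Q p := hQc p <| by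
    rw [commute_iff_eq, add_mul, mul_add, hp.one_sub_mul_self, hp.mul_one_sub_self, pb, bp]
  have hP : IsStarProjection (Q * p) := hQ.mul hp hcomm
  have hR : IsStarProjection ((1 - Q) * p) :=
    hQ.one_sub.mul hp ((Commute.one_left p).sub_left hcomm)
  have key : ∀ R : A, Commute R p → R * p * b * (R * p) = p * (R * (b + (1 - p)) * R) * p := by
    intro R hR
    have h1 : p * (b + (1 - p)) * p = b := by
      rw [mul_add, hp.mul_one_sub_self, add_zero, pb, bp]
    have h2 : ∀ z, p * (p * z) = p * z := fun z => by rw [← mul_assoc, pp]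
    have h3 : ∀ z, R * (p * z) = p * (R * z) := fun z => by rw [← mul_assoc, hR.eq, mul_assoc]
    conv_lhs => rw [← h1]
    simp only [mul_assoc, hR.eq, h2, h3]
  have hpP : p - Q * p = (1 - Q) * p := by rw [sub_mul, one_mul]
  refine ⟨Q * p, hP, by rw [← mul_assoc, ← hcomm.eq, mul_assoc, pp], ?_, ?_⟩
  · have h1 : 0 ≤ Q * p * b * (Q * p) := by
      rw [key Q hcomm]
      simpa using hp.conj_mono hQ1
    have h2 := hP.conj_mono (neg_smul_one_le sab hab.le)
    calc -(δ • (Q * p)) = Q * p * -(δ • 1) * (Q * p) := by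
          simp only [mul_neg, neg_mul, mul_smul_comm, mul_one, smul_mul_assoc, hP.isIdempotentElem.eq]
      _ ≤ Q * p * (a - b) * (Q * p) := h2
      _ ≤ Q * p * (a - b) * (Q * p) + Q * p * b * (Q * p) := le_add_of_nonneg_right h1
      _ = _ := by rw [← add_mul, ← mul_add, sub_add_cancel]
  · rw [hpP]
    have h1 : (1 - Q) * p * b * ((1 - Q) * p) ≤ 0 := by
      rw [key _ ((Commute.one_left p).sub_left hcomm)]
      simpa using hp.conj_mono hQ2
    have h2 := hR.conj_mono (le_smul_one sab hab.le)
    calc _ = (1 - Q) * p * (a - b) * ((1 - Q) * p) + (1 - Q) * p * b * ((1 - Q) * p) := by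
          rw [← add_mul, ← mul_add, sub_add_cancel]
      _ ≤ (1 - Q) * p * (a - b) * ((1 - Q) * p) := add_le_of_nonpos_right h1
      _ ≤ _ := h2
      _ = _ := by
        simp only [mul_smul_comm, mul_one, smul_mul_assoc, hR.isIdempotentElem.eq]

/-- Split `y - ‖y‖/2` with tolerance `‖y‖/6`. The positive part gives the bound `1/2 - 1/6 = 1/3`;
were it zero, `y ≤ (2/3)‖y‖` would follow. -/
theorem HasRealRankZero.exists_projection_smul_le (hrr : HasRealRankZero A) {y : A} (hy : 0 ≤ y)
    (hy0 : y ≠ 0) : ∃ P, IsStarProjection P ∧ P ≠ 0 ∧ (‖y‖ / 3) • P ≤ P * y * P := by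
  have hn : 0 < ‖y‖ := norm_pos_iff.2 hy0
  have sy : IsSelfAdjoint y := .of_nonneg hy
  have s1 : IsSelfAdjoint ((‖y‖ / 2) • (1 : A)) := (IsSelfAdjoint.all (‖y‖ / 2)).smul (.one A)
  obtain ⟨P, hP, -, h1, h2⟩ := hrr.exists_projection (a := y - (‖y‖ / 2) • (1 : A))
    (IsStarProjection.one A) (sy.sub s1) (by rw [one_mul, mul_one]) (δ := ‖y‖ / 6) (by positivity)
  refine ⟨P, hP, ?_, ?_⟩
  · rintro rfl
    simp only [sub_zero, one_mul, mul_one, sub_le_iff_le_add, ← add_smul] at h2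
    have := (CStarAlgebra.norm_le_iff_le_algebraMap y (r := ‖y‖ / 6 + ‖y‖ / 2) (by positivity)).2
      (by rwa [Algebra.algebraMap_eq_smul_one])
    linarith
  · rw [mul_sub, sub_mul, mul_smul_comm, mul_one, smul_mul_assoc, hP.isIdempotentElem.eq,
      le_sub_iff_add_le, ← neg_smul, ← add_smul] at h1
    convert h1 using 2
    ring

end RealRankZero

/-! ### Riesz decomposition of projections. -/

section Riesz

variable {A : Type*} [CStarAlgebra A] [PartialOrder A] [StarOrderedRing A]

/-- Riesz decomposition: a projection below `q₁ + q₂` is a sum of projections subequivalent to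
`q₁` and to `q₂`. -/
theorem HasRealRankZero.exists_add_eq (hrr : HasRealRankZero A) {p q₁ q₂ : A}
    (hp : IsStarProjection p) (hq₁ : IsStarProjection q₁) (hq₂ : IsStarProjection q₂)
    (h : (q₁ + q₂) * p = p) :
    ∃ p₁ p₂, IsStarProjection p₁ ∧ IsStarProjection p₂ ∧ p₁ * p₂ = 0 ∧ p₁ + p₂ = p ∧
      MvNSubequiv p₁ q₁ ∧ MvNSubequiv p₂ q₂ := by
  have pp : p * p = p := hp.isIdempotentElem
  have sp : star p = p := hp.isSelfAdjoint
  -- Cut `p q₁ p` at height `1/2` with tolerance `1/4`. On one piece `q₁` compresses to at least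
  -- `1/4`; on the other to at most `3/4`, so there `q₂` compresses to at least `1/4`, since `q₁ +
  -- q₂` acts as the identity on `p`.
  have hs : IsSelfAdjoint (p * q₁ * p - (1 / 2 : ℝ) • p) := by
    refine IsSelfAdjoint.sub ?_ ((IsSelfAdjoint.all (1 / 2 : ℝ)).smul hp.isSelfAdjoint)
    rw [IsSelfAdjoint, star_mul, star_mul, sp, hq₁.isSelfAdjoint.star_eq, mul_assoc]
  obtain ⟨P, hP, hpP, h1, h2⟩ := hrr.exists_projection hp hs (by
    rw [mul_sub, sub_mul]
    congr 1
    · simp only [← mul_assoc, pp]; simp only [mul_assoc, pp]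
    · simp only [mul_smul_comm, smul_mul_assoc, pp]) (δ := 1 / 4) (by norm_num)
  have hPp : P * p = P := (hp.mul_eq_comm hP).1 hpP
  have hcompr : ∀ R : A, IsStarProjection R → p * R = R → R * p = R →
      R * (p * q₁ * p - (1 / 2 : ℝ) • p) * R = R * q₁ * R - (1 / 2 : ℝ) • R := by
    intro R hR h₁ h₂
    rw [mul_sub, sub_mul, mul_smul_comm, h₂, smul_mul_assoc, hR.isIdempotentElem.eq]
    congr 1
    simp only [← mul_assoc, h₂]
    simp only [mul_assoc, h₁]
  have hQ : IsStarProjection (p - P) := hP.sub_of_mul_eq_right hp hpP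
  rw [hcompr P hP hpP hPp] at h1
  rw [hcompr (p - P) hQ (by rw [mul_sub, pp, hpP]) (by rw [sub_mul, pp, hPp])] at h2
  refine ⟨P, p - P, hP, hQ, by rw [mul_sub, hPp, hP.isIdempotentElem.eq, sub_self], by abel,
    mvNSubequiv_of_smul_le (κ := 1 / 4) hP hq₁ (by norm_num) ?_,
    mvNSubequiv_of_smul_le (κ := 1 / 4) hQ hq₂ (by norm_num) ?_⟩
  · rw [le_sub_iff_add_le, ← neg_smul, ← add_smul] at h1
    convert h1 using 2
    norm_num
  · have h3 : (p - P) * q₁ * (p - P) + (p - P) * q₂ * (p - P) = p - P := by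
      have : (q₁ + q₂) * (p - P) = p - P := by
        conv_lhs => rw [← hpP]
        rw [mul_sub, ← mul_assoc, h, hpP]
      rw [← add_mul, ← mul_add, mul_assoc, this, hQ.isIdempotentElem.eq]
    rw [sub_le_iff_le_add, ← add_smul] at h2
    rw [← eq_sub_iff_add_eq'] at h3
    rw [h3, le_sub_iff_add_le, ← le_sub_iff_add_le']
    refine h2.trans (le_of_eq ?_)
    conv_rhs => enter [1]; rw [← one_smul ℝ (p - P)]
    rw [← sub_smul]
    norm_num

/-- Riesz decomposition is iterated, splitting off one `e a` at a time. The result trades a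
projection under `∑ e i` for an equivalent one that is block diagonal. -/
theorem HasRealRankZero.exists_mvNEquiv_sum (hrr : HasRealRankZero A) {ι : Type*} [DecidableEq ι]
    {e : ι → A} (he : ∀ i, IsStarProjection (e i)) (hd : ∀ i j, i ≠ j → e i * e j = 0)
    (s : Finset ι) {p : A} (hp : IsStarProjection p) (h : (∑ i ∈ s, e i) * p = p) :
    ∃ r : ι → A, (∀ i, IsStarProjection (r i)) ∧ (∀ i, e i * r i = r i) ∧
      MvNEquiv p (∑ i ∈ s, r i) := by
  induction s using Finset.induction_on generalizing p with
  | empty =>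
    rw [Finset.sum_empty, zero_mul] at h
    exact ⟨0, fun _ => IsStarProjection.zero A, fun _ => mul_zero _, by
      rw [← h, Finset.sum_empty]; exact MvNEquiv.refl (IsStarProjection.zero A)⟩
  | insert a s has ih =>
    rw [Finset.sum_insert has] at h
    obtain ⟨p₁, p₂, hp₁, hp₂, hpp, rfl, ⟨r₁, hr₁, her₁, h₁⟩, r₂, hr₂, her₂, h₂⟩ :=
      hrr.exists_add_eq hp (he a)
        (IsStarProjection.finset_sum s (fun i _ => he i) fun i _ j _ => hd i j) h
    obtain ⟨r, hr, her, hrs⟩ := ih hr₂ her₂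
    have hre : ∀ i, r i * e i = r i := fun i => ((he i).mul_eq_comm (hr i)).1 (her i)
    have hsum : IsStarProjection (∑ i ∈ s, r i) :=
      IsStarProjection.finset_sum s (fun i _ => hr i) fun i _ j _ hij => by
        rw [← hre i, ← her j, mul_assoc, ← mul_assoc (e i), hd i j hij, zero_mul, mul_zero]
    have hupd : ∑ i ∈ s, Function.update r a r₁ i = ∑ i ∈ s, r i :=
      Finset.sum_congr rfl fun i hi => Function.update_of_ne (by rintro rfl; exact has hi) _ _
    refine ⟨Function.update r a r₁, fun i => ?_, fun i => ?_, ?_⟩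
    · rcases eq_or_ne i a with rfl | hi
      · simpa using hr₁
      · simpa [hi] using hr i
    · rcases eq_or_ne i a with rfl | hi
      · simpa using her₁
      · simpa [hi] using her i
    · rw [Finset.sum_insert has, Function.update_self, hupd]
      refine MvNEquiv.add hp₁ hp₂ hr₁ hsum hpp ?_ h₁ (h₂.trans hp₂ hsum hrs)
      rw [Finset.mul_sum]
      refine Finset.sum_eq_zero fun i hi => ?_
      rw [← ((he a).mul_eq_comm hr₁).1 her₁, ← her i, mul_assoc, ← mul_assoc (e a),
        hd a i (by rintro rfl; exact has hi), zero_mul, mul_zero]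

end Riesz

/-! ### Tracial states on projections. -/

section Traces

variable {A : Type*} [CStarAlgebra A] {τ : A →L[ℂ] ℂ}

theorem IsTracialState.re_nonneg (hτ : IsTracialState τ) {p : A} (hp : IsStarProjection p) :
    0 ≤ (τ p).re := by
  have := (hτ.nonneg p).1
  rwa [hp.isSelfAdjoint.star_eq, hp.isIdempotentElem.eq] at this

theorem IsTracialState.eq_of_mvNEquiv (hτ : IsTracialState τ) {p q : A} (h : MvNEquiv p q) :
    τ p = τ q := by
  obtain ⟨v, rfl, rfl⟩ := h
  exact hτ.trace _ _

theorem IsTracialState.re_le_of_mvNSubequiv (hτ : IsTracialState τ) {p q : A}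
    (hq : IsStarProjection q) (h : MvNSubequiv p q) : (τ p).re ≤ (τ q).re := by
  obtain ⟨r, hr, hqr, hpr⟩ := h
  have := hτ.re_nonneg (hr.sub_of_mul_eq_right hq hqr)
  rw [map_sub, Complex.sub_re] at this
  rw [hτ.eq_of_mvNEquiv hpr]
  linarith

theorem IsTracialState.re_le_one (hτ : IsTracialState τ) {p : A} (hp : IsStarProjection p) :
    (τ p).re ≤ 1 := by
  have := hτ.re_le_of_mvNSubequiv (IsStarProjection.one A) ⟨p, hp, one_mul p, MvNEquiv.refl hp⟩
  rwa [hτ.map_one, Complex.one_re] at this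

theorem OrderDeterminedByTraces.mvNSubequiv (hord : OrderDeterminedByTraces A) {p q : A}
    (hp : IsStarProjection p) (hq : IsStarProjection q)
    (h : ∀ τ : A →L[ℂ] ℂ, IsTracialState τ → (τ p).re < (τ q).re) : MvNSubequiv p q := by
  have hmat : ∀ {a : A}, IsStarProjection a →
      IsStarProjection (Matrix.of fun _ _ : Fin 1 => a) := fun {a} ha =>
    ⟨by ext; simp [Matrix.mul_apply, ha.isIdempotentElem.eq],
      by ext; simp [Matrix.star_apply, ha.isSelfAdjoint.star_eq]⟩
  obtain ⟨r, hr, hqr, v, hv, hv'⟩ := hord 1 _ _ (hmat hp) (hmat hq) (by simpa using h)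
  have e₁ := congrFun (congrFun hr.isIdempotentElem.eq 0) 0
  have e₂ := congrFun (congrFun hr.isSelfAdjoint.star_eq 0) 0
  have e₃ := congrFun (congrFun hqr 0) 0
  have e₄ := congrFun (congrFun hv 0) 0
  have e₅ := congrFun (congrFun hv' 0) 0
  simp only [Matrix.mul_apply, Matrix.star_apply, Finset.univ_unique, Fin.default_eq_zero,
    Finset.sum_singleton, Matrix.of_apply] at e₁ e₂ e₃ e₄ e₅
  exact ⟨r 0 0, ⟨e₁, e₂⟩, e₃, v 0 0, e₄, e₅⟩

end Traces

/-! ### Algebraic consequences of simplicity. -/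

section SimpleCStar

variable {A : Type*} [CStarAlgebra A]

/-- The closure of the ideal generated by `p` is all of `A`, so the ideal itself contains an element
at distance less than `1` from `1`. That element is invertible, and multiplying by its inverse stays
in the ideal. -/
theorem IsSimpleCStar.exists_sum_mul_mul_eq_one (hs : IsSimpleCStar A) {p : A} (hp : p ≠ 0) :
    ∃ (n : ℕ) (x y : Fin n → A), ∑ i, x i * p * y i = 1 := by
  let S : Set A := {z | ∃ (n : ℕ) (x y : Fin n → A), ∑ i, x i * p * y i = z}
  have S0 : (0 : A) ∈ S := ⟨0, 0, 0, by simp⟩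
  have Sadd : ∀ {a b}, a ∈ S → b ∈ S → a + b ∈ S := by
    rintro _ _ ⟨n, x, y, rfl⟩ ⟨m, x', y', rfl⟩
    exact ⟨n + m, Fin.append x x', Fin.append y y', by simp [Fin.sum_univ_add]⟩
  have Smul : ∀ c d : A, ∀ a ∈ S, c * a * d ∈ S := by
    rintro c d _ ⟨n, x, y, rfl⟩
    exact ⟨n, fun i => c * x i, fun i => y i * d, by
      simp only [Finset.mul_sum, Finset.sum_mul, mul_assoc]⟩
  let I : TwoSidedIdeal A := TwoSidedIdeal.mk' (closure S) (subset_closure S0)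
    (fun {a b} ha hb => map_mem_closure₂ continuous_add ha hb fun _ h _ h' => Sadd h h')
    (fun {a} ha => map_mem_closure continuous_neg ha fun b hb => by
      simpa using Smul (-1) 1 b hb)
    (fun {c a} ha => map_mem_closure (continuous_const_mul c) ha fun b hb => by
      simpa using Smul c 1 b hb)
    (fun {a c} ha => map_mem_closure (f := fun z => z * c) (continuous_mul_const c) ha fun b hb => by
      simpa using Smul 1 c b hb)
  have hI : ∀ a, a ∈ I ↔ a ∈ closure S := fun a => TwoSidedIdeal.mem_mk' ..
  have h1 : (1 : A) ∈ closure S := by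
    rw [← hI]
    rcases hs.2 I (by simp only [hI]; exact isClosed_closure) with h | h
    · have hpI : p ∈ I := (hI p).2 (subset_closure ⟨1, 1, 1, by simp⟩)
      rw [h, TwoSidedIdeal.mem_bot] at hpI
      exact absurd hpI hp
    · rw [h]; trivial
  obtain ⟨a, ha, hda⟩ := Metric.mem_closure_iff.1 h1 1 one_pos
  rw [dist_eq_norm] at hda
  have hu : IsUnit a := by simpa using (Units.oneSub (1 - a) hda).isUnit
  have := Smul (hu.unit⁻¹ : Aˣ).1 1 a ha
  rwa [mul_one, hu.val_inv_mul] at this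

theorem IsSimpleCStar.exists_mul_mul_ne_zero (hs : IsSimpleCStar A) {p q : A} (hp : p ≠ 0)
    (hq : q ≠ 0) : ∃ a, p * a * q ≠ 0 := by
  by_contra! h
  obtain ⟨n, x, y, hxy⟩ := hs.exists_sum_mul_mul_eq_one hp
  refine hq ?_
  rw [← one_mul q, ← hxy, Finset.sum_mul]
  exact Finset.sum_eq_zero fun i _ => by rw [mul_assoc, mul_assoc, ← mul_assoc p, h, mul_zero]

/-- Writing `1 = ∑ x i p y i` on both sides of `a` exhibits `a` as a combination of the finitely
many `x i p y j`, because each `p (y i a x j) p` is a multiple of `p`. -/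
theorem IsSimpleCStar.finiteDimensional_of_corner (hs : IsSimpleCStar A) {p : A} (hp : p ≠ 0)
    (h : ∀ a, ∃ c : ℂ, p * a * p = c • p) : FiniteDimensional ℂ A := by
  obtain ⟨n, x, y, hxy⟩ := hs.exists_sum_mul_mul_eq_one hp
  choose c hc using h
  refine Module.Finite.of_surjective (Fintype.linearCombination ℂ
    fun ij : Fin n × Fin n => x ij.1 * p * y ij.2) fun a => ?_
  refine ⟨fun ij => c (y ij.1 * a * x ij.2), ?_⟩
  rw [Fintype.linearCombination_apply, Fintype.sum_prod_type]
  have : a = (∑ i, x i * p * y i) * a * ∑ j, x j * p * y j := by rw [hxy, one_mul, mul_one]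
  conv_rhs => rw [this]
  rw [Finset.sum_mul, Finset.sum_mul]
  refine Finset.sum_congr rfl fun i _ => ?_
  rw [Finset.mul_sum]
  refine Finset.sum_congr rfl fun j _ => ?_
  calc c (y i * a * x j) • (x i * p * y j) = x i * (c (y i * a * x j) • p) * y j := by
        rw [mul_smul_comm, smul_mul_assoc]
    _ = _ := by rw [← hc]; simp only [mul_assoc]

end SimpleCStar

/-! ### Projections of small trace. -/

section Halving

variable {A : Type*} [CStarAlgebra A] [PartialOrder A] [StarOrderedRing A]

/-- Minimality makes the splitting of `a - t p` trivial, so for every real `t` the element `a` lies,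
up to `δ`, entirely below or entirely above `t p`. The scalar is the cut between the two
alternatives. -/
theorem HasRealRankZero.exists_eq_smul_of_minimal (hrr : HasRealRankZero A) {p : A}
    (hp : IsStarProjection p) (hp0 : p ≠ 0)
    (hmin : ∀ P, IsStarProjection P → p * P = P → P = 0 ∨ P = p) {a : A} (ha : IsSelfAdjoint a)
    (hpa : p * a * p = a) : ∃ t : ℝ, a = t • p := by
  have pp : p * p = p := hp.isIdempotentElem
  have hdich : ∀ t δ : ℝ, 0 < δ → a ≤ (t + δ) • p ∨ (t - δ) • p ≤ a := by
    intro t δ hδ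
    have hcompr : p * (a - t • p) * p = a - t • p := by
      rw [mul_sub, sub_mul, hpa, mul_smul_comm, smul_mul_assoc, pp, pp]
    obtain ⟨P, hP, hpP, h1, h2⟩ := hrr.exists_projection hp
      (ha.sub ((IsSelfAdjoint.all t).smul hp.isSelfAdjoint)) hcompr hδ
    rcases hmin P hP hpP with rfl | rfl
    · left
      rw [sub_zero, hcompr, sub_le_iff_le_add] at h2
      rwa [add_comm t, add_smul]
    · right
      rw [hcompr, le_sub_iff_add_le] at h1
      convert h1 using 1
      module
  have hle : ∀ t : ℝ, t • p ≤ a → t ≤ ‖a‖ := by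
    intro t ht
    by_contra! hlt
    have h1 : a ≤ ‖a‖ • p := by
      have := hp.conj_mono (le_norm_smul_one ha)
      rwa [hpa, mul_smul_comm, mul_one, smul_mul_assoc, pp] at this
    have h2 : (t - ‖a‖) • p ≤ 0 := by
      rw [sub_smul, sub_nonpos]
      exact ht.trans h1
    have h3 := le_antisymm h2 (hp.real_smul_nonneg (sub_pos.2 hlt).le)
    rcases smul_eq_zero.1 h3 with h | h
    · linarith
    · exact hp0 h
  let S : Set ℝ := {t | t • p ≤ a}
  have hne : S.Nonempty := ⟨-‖a‖, by
    have := hp.conj_mono (neg_norm_smul_one_le ha)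
    rw [hpa] at this
    change (-‖a‖) • p ≤ a
    simpa [pp] using this⟩
  have hbdd : BddAbove S := ⟨‖a‖, hle⟩
  have hlow : ∀ ε : ℝ, 0 < ε → (sSup S - ε) • p ≤ a := by
    intro ε hε
    obtain ⟨t, ht, hlt⟩ := exists_lt_of_lt_csSup hne (sub_lt_self (sSup S) hε)
    exact (smul_le_smul_of_nonneg_right hlt.le hp.nonneg).trans ht
  have hup : ∀ ε : ℝ, 0 < ε → a ≤ (sSup S + ε) • p := by
    intro ε hε
    -- With this choice the upper alternative is the goal, while the lower one would put `sSup S +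
    -- ε/2` into `S`.
    rcases hdich (sSup S + ε * (3 / 4)) (ε / 4) (by positivity) with h | h
    · convert h using 2; ring
    · have := le_csSup hbdd h
      linarith
  have hcont : Continuous fun ε : ℝ => (sSup S + ε) • p := by fun_prop
  have hcont' : Continuous fun ε : ℝ => (sSup S - ε) • p := by fun_prop
  refine ⟨sSup S, le_antisymm ?_ ?_⟩
  · have h := (hcont.tendsto 0).mono_left (nhdsWithin_le_nhds (s := Set.Ioi 0))
    rw [add_zero] at h
    exact ge_of_tendsto h (by filter_upwards [self_mem_nhdsWithin] with ε hε using hup ε hε)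
  · have h := (hcont'.tendsto 0).mono_left (nhdsWithin_le_nhds (s := Set.Ioi 0))
    rw [sub_zero] at h
    exact le_of_tendsto h (by filter_upwards [self_mem_nhdsWithin] with ε hε using hlow ε hε)

theorem exists_proper_subprojection (hinf : ¬ FiniteDimensional ℂ A) (hs : IsSimpleCStar A)
    (hrr : HasRealRankZero A) {p : A} (hp : IsStarProjection p) (hp0 : p ≠ 0) :
    ∃ P, IsStarProjection P ∧ p * P = P ∧ P ≠ 0 ∧ P ≠ p := by
  by_contra! hmin
  have hmin' : ∀ P, IsStarProjection P → p * P = P → P = 0 ∨ P = p := fun P h h' =>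
    or_iff_not_imp_left.2 (hmin P h h')
  have pp : p * p = p := hp.isIdempotentElem
  have key : ∀ a : A, IsSelfAdjoint a → ∃ t : ℝ, p * a * p = t • p := fun a ha =>
    hrr.exists_eq_smul_of_minimal hp hp0 hmin'
      (by simpa [hp.isSelfAdjoint.star_eq] using ha.conjugate p)
      (by simp only [← mul_assoc, pp]; simp only [mul_assoc, pp])
  refine hinf (hs.finiteDimensional_of_corner hp0 fun a => ?_)
  obtain ⟨t, ht⟩ := key _ (realPart a).2
  obtain ⟨s, hs⟩ := key _ (imaginaryPart a).2
  refine ⟨t + Complex.I * s, ?_⟩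
  conv_lhs => rw [← realPart_add_I_smul_imaginaryPart a]
  rw [mul_add, add_mul, ht, mul_smul_comm, smul_mul_assoc, hs, add_smul, mul_smul]
  simp

/-- Split `p` into nonzero `p₁` and `p₂`; simplicity gives a nonzero `c = p₁ a p₂`. A projection on
which `c⋆c` is bounded below is carried under `p₁` by `c`, and is subequivalent to `p₂` because `c⋆c
≤ ‖p₁ a‖² p₂`. Adding the two trace inequalities gives the factor `2`. -/
theorem exists_half_projection (hinf : ¬ FiniteDimensional ℂ A) (hs : IsSimpleCStar A)
    (hrr : HasRealRankZero A) {p : A} (hp : IsStarProjection p) (hp0 : p ≠ 0) :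
    ∃ q, IsStarProjection q ∧ q ≠ 0 ∧ MvNSubequiv q p ∧
      ∀ τ : A →L[ℂ] ℂ, IsTracialState τ → 2 * (τ q).re ≤ (τ p).re := by
  obtain ⟨p₁, hp₁, hpp₁, hp₁0, hp₁p⟩ := exists_proper_subprojection hinf hs hrr hp hp0
  have hp₂ : IsStarProjection (p - p₁) := hp₁.sub_of_mul_eq_right hp hpp₁
  obtain ⟨a, ha⟩ := hs.exists_mul_mul_ne_zero hp₁0 (sub_ne_zero.2 hp₁p.symm)
  set p₂ := p - p₁ with hp₂def
  set c := p₁ * a * p₂ with hc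
  obtain ⟨P, hP, hP0, hle⟩ := hrr.exists_projection_smul_le (star_mul_self_nonneg c)
    (by rwa [Ne, CStarRing.star_mul_self_eq_zero_iff])
  have hκ : 0 < ‖star c * c‖ / 3 := by
    have : 0 < ‖star c * c‖ := norm_pos_iff.2 (by rwa [Ne, CStarRing.star_mul_self_eq_zero_iff])
    positivity
  have ha0 : 0 < ‖p₁ * a‖ ^ 2 := by
    have : 0 < ‖p₁ * a‖ := norm_pos_iff.2 fun h => ha (by rw [hc, h, zero_mul])
    positivity
  have hcc : P * (star c * c) * P ≤ ‖p₁ * a‖ ^ 2 • (P * p₂ * P) := by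
    have h1 : star c * c = p₂ * (star (p₁ * a) * (p₁ * a)) * p₂ := by
      rw [hc, star_mul, hp₂.isSelfAdjoint.star_eq]; simp only [mul_assoc]
    have h2 : star (p₁ * a) * (p₁ * a) ≤ ‖p₁ * a‖ ^ 2 • (1 : A) := by
      simpa [Algebra.algebraMap_eq_smul_one] using
        CStarAlgebra.star_mul_le_algebraMap_norm_sq (a := p₁ * a)
    have h3 := hP.conj_mono (hp₂.conj_mono h2)
    rw [← h1, mul_smul_comm, mul_one, smul_mul_assoc, hp₂.isIdempotentElem.eq, mul_smul_comm,
      smul_mul_assoc] at h3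
    exact h3
  have hP₂ : MvNSubequiv P p₂ := by
    refine mvNSubequiv_of_smul_le (κ := (‖p₁ * a‖ ^ 2)⁻¹ * (‖star c * c‖ / 3)) hP hp₂
      (by positivity) ?_
    have := smul_le_smul_of_nonneg_left (hle.trans hcc) (inv_pos.2 ha0).le
    rwa [smul_smul, smul_smul, inv_mul_cancel₀ ha0.ne', one_smul] at this
  have hP₁ : MvNSubequiv P p₁ := by
    obtain ⟨y, -, hy⟩ := exists_star_mul_self_eq_of_smul_le (b := c * P) hP
      (by rw [mul_assoc, hP.isIdempotentElem.eq]) hκ (by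
        rw [star_mul c P, hP.isSelfAdjoint.star_eq]
        convert hle using 1
        simp only [mul_assoc])
    refine ⟨_, isStarProjection_mul_star hP hy, ?_, _, hy, rfl⟩
    simp only [hc, ← mul_assoc, hp₁.isIdempotentElem.eq]
  refine ⟨P, hP, hP0, hP₁.trans hP ⟨p₁, hp₁, hpp₁, MvNEquiv.refl hp₁⟩, fun τ hτ => ?_⟩
  have h1 := hτ.re_le_of_mvNSubequiv hp₁ hP₁
  have h2 := hτ.re_le_of_mvNSubequiv hp₂ hP₂
  rw [hp₂def, map_sub, Complex.sub_re] at h2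
  linarith

theorem exists_small_projection (hinf : ¬ FiniteDimensional ℂ A) (hs : IsSimpleCStar A)
    (hrr : HasRealRankZero A) {p : A} (hp : IsStarProjection p) (hp0 : p ≠ 0) (k : ℕ) :
    ∃ q, IsStarProjection q ∧ q ≠ 0 ∧ MvNSubequiv q p ∧
      ∀ τ : A →L[ℂ] ℂ, IsTracialState τ → 2 ^ k * (τ q).re ≤ (τ p).re := by
  induction k with
  | zero => exact ⟨p, hp, hp0, ⟨p, hp, hp.isIdempotentElem, MvNEquiv.refl hp⟩, by simp⟩
  | succ k ih =>
    obtain ⟨q, hq, hq0, hqp, hτq⟩ := ih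
    obtain ⟨r, hr, hr0, hrq, hτr⟩ := exists_half_projection hinf hs hrr hq hq0
    refine ⟨r, hr, hr0, hrq.trans hr hqp, fun τ hτ => ?_⟩
    have h1 := hτq τ hτ
    have h2 := hτr τ hτ
    rw [pow_succ, mul_assoc]
    exact (mul_le_mul_of_nonneg_left h2 (by positivity)).trans h1

end Halving

/-! ### Partial isometries between close projections. -/

section CloseProjections

variable {A : Type*} [CStarAlgebra A]

/-- The phase `s = x |x|⁻¹` of an invertible selfadjoint element `x`. -/
theorem exists_symmetry {x : A} (sx : IsSelfAdjoint x) (hux : IsUnit x) :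
    ∃ k s : A, s = x * k ∧ (∀ z, Commute (x * x) z → Commute k z) ∧ star s = s ∧ s * s = 1 ∧
      ‖s - x‖ ≤ ‖1 - x * x‖ := by
  have h0 : ∀ t ∈ spectrum ℝ x, t ≠ 0 := fun t ht h => spectrum.zero_notMem ℝ hux (h ▸ ht)
  have hc : ContinuousOn (fun t : ℝ => |t|⁻¹) (spectrum ℝ x) :=
    continuous_abs.continuousOn.inv₀ fun t ht => abs_ne_zero.2 (h0 t ht)
  have hid : ContinuousOn (fun t : ℝ => t) (spectrum ℝ x) := continuousOn_id
  have hsq : ContinuousOn (fun t : ℝ => t * t) (spectrum ℝ x) := hid.mul hid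
  have hc' : ContinuousOn (fun t : ℝ => t * |t|⁻¹) (spectrum ℝ x) := hid.mul hc
  have h2 : x * x = cfc (fun t : ℝ => t * t) x := by
    rw [cfc_mul (fun t : ℝ => t) (fun t => t) x hid hid, cfc_id' ℝ x]
  refine ⟨cfc (fun t : ℝ => |t|⁻¹) x, cfc (fun t : ℝ => t * |t|⁻¹) x, ?_, fun z hz => ?_,
    cfc_predicate (fun t : ℝ => t * |t|⁻¹) x, ?_, ?_⟩
  · rw [cfc_mul (fun t : ℝ => t) (fun t => |t|⁻¹) x hid hc, cfc_id' ℝ x]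
  -- Since `|t| = √(t²)`, `|x|⁻¹` is a function of `x²`, and so commutes with everything that
  -- commutes with `x²`.
  · have h3 : cfc (fun t : ℝ => |t|⁻¹) x = cfc (fun t : ℝ => (√t)⁻¹) (x * x) := by
      rw [h2, ← cfc_comp' (fun t : ℝ => (√t)⁻¹) (fun t : ℝ => t * t) x ?_ hsq sx]
      · simp only [Real.sqrt_mul_self_eq_abs]
      · refine ContinuousOn.inv₀ Real.continuous_sqrt.continuousOn ?_
        rintro _ ⟨t, ht, rfl⟩
        simpa only [Real.sqrt_mul_self_eq_abs, abs_ne_zero] using h0 t ht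
    rw [h3]
    exact hz.cfc_real _
  · rw [← cfc_mul _ _ x hc' hc']
    refine Eq.trans (cfc_congr fun t ht => ?_) (cfc_const_one ℝ x)
    change t * |t|⁻¹ * (t * |t|⁻¹) = 1
    have := abs_ne_zero.2 (h0 t ht)
    rw [mul_mul_mul_comm, ← abs_mul_abs_self t, ← mul_inv, mul_inv_cancel₀ (mul_ne_zero this this)]
  · have h1 : cfc (fun t : ℝ => t * |t|⁻¹) x - x = cfc (fun t : ℝ => t * |t|⁻¹ - t) x := by
      rw [cfc_sub (fun t : ℝ => t * |t|⁻¹) (fun t => t) x hc' hid, cfc_id' ℝ x]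
    have h2' : 1 - x * x = cfc (fun t : ℝ => 1 - t * t) x := by
      rw [cfc_sub (fun _ : ℝ => (1 : ℝ)) (fun t => t * t) x continuousOn_const hsq,
        cfc_const_one ℝ x, h2]
    rw [h1]
    refine norm_cfc_le (norm_nonneg _) fun t ht => ?_
    have h3 : ‖1 - t * t‖ ≤ ‖1 - x * x‖ := by
      rw [h2']
      exact norm_apply_le_norm_cfc (fun t : ℝ => 1 - t * t) x ht (continuousOn_const.sub hsq)
    refine le_trans ?_ h3
    have h4 : 0 < |t| := abs_pos.2 (h0 t ht)
    have h5 : t * |t|⁻¹ - t = (t * |t|⁻¹) * (1 - |t|) := by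
      rw [mul_sub, mul_one, mul_assoc, inv_mul_cancel₀ h4.ne', mul_one]
    have h6 : |t * |t|⁻¹| = 1 := by
      rw [abs_mul, abs_inv, abs_abs, mul_inv_cancel₀ h4.ne']
    have h7 : 1 - t * t = (1 - |t|) * (1 + |t|) := by
      rw [← abs_mul_abs_self t]; ring
    rw [Real.norm_eq_abs, Real.norm_eq_abs, h5, h7, abs_mul, h6, one_mul, abs_mul]
    refine le_mul_of_one_le_right (abs_nonneg _) ?_
    rw [abs_of_pos (by linarith)]
    linarith

/-- The selfadjoint element `x = p + q - 1` satisfies `x p = q p = q x`, and `x² = 1 - (p - q)²` is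
invertible and commutes with `p`. Its phase `s` is therefore a symmetry with `s p = q s`, and `w = s
p` works, with `‖w - q‖ ≤ ‖p - q‖² + ‖p - q‖`. -/
theorem exists_star_mul_self_eq_of_norm_sub_lt_one {p q : A} (hp : IsStarProjection p)
    (hq : IsStarProjection q) (hpq : ‖p - q‖ < 1) :
    ∃ w, star w * w = p ∧ w * star w = q ∧ ‖w - q‖ ≤ 2 * ‖p - q‖ := by
  have pp : p * p = p := hp.isIdempotentElem
  have qq : q * q = q := hq.isIdempotentElem
  obtain ⟨x, hx⟩ : ∃ x, x = p + q - 1 := ⟨_, rfl⟩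
  have sx : IsSelfAdjoint x := hx ▸ (hp.isSelfAdjoint.add hq.isSelfAdjoint).sub (.one A)
  have hxp : x * p = q * p := by rw [hx, sub_mul, add_mul, pp, one_mul]; abel
  have hqx : q * x = q * p := by rw [hx, mul_sub, mul_add, qq, mul_one]; abel
  have hxx : x * x = 1 - (p - q) * (p - q) := by
    simp only [hx, sub_mul, mul_sub, add_mul, mul_add, pp, qq, one_mul, mul_one]; abel
  have hxx1 : ‖1 - x * x‖ ≤ ‖p - q‖ * ‖p - q‖ := by
    rw [hxx, sub_sub_cancel]
    exact norm_mul_le _ _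
  have hn := norm_nonneg (p - q)
  have hux : IsUnit x := by
    have h1 : IsUnit (x * x) := by
      have := (Units.oneSub (1 - x * x) (hxx1.trans_lt (by nlinarith))).isUnit
      simpa using this
    exact ((Commute.refl x).isUnit_mul_iff.1 h1).1
  obtain ⟨k, s, hsk, hk, ss, hss, hsx'⟩ := exists_symmetry sx hux
  have hkp : Commute k p := by
    refine hk p ?_
    rw [commute_iff_eq, hxx]
    simp only [sub_mul, mul_sub, pp, qq, one_mul, mul_one, mul_assoc]
    simp only [← mul_assoc, pp]
    abel
  have hsp : s * p = q * s := by
    rw [hsk, mul_assoc, hkp.eq, ← mul_assoc, hxp, ← hqx, mul_assoc]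
  have hsx := hsx'.trans hxx1
  refine ⟨s * p, ?_, ?_, ?_⟩
  · rw [star_mul, ss, hp.isSelfAdjoint.star_eq, mul_assoc, ← mul_assoc s, hss, one_mul, pp]
  · rw [star_mul, ss, hp.isSelfAdjoint.star_eq, mul_assoc, ← mul_assoc p, pp, ← mul_assoc, hsp,
      mul_assoc, hss, mul_one]
  · have h1 : s * p - q = (s - x) * p + q * (p - q) := by
      rw [sub_mul, mul_sub, hxp, qq]; abel
    rw [h1]
    refine (norm_add_le _ _).trans ?_
    have h2 : ‖(s - x) * p‖ ≤ ‖p - q‖ * ‖p - q‖ * 1 :=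
      (norm_mul_le _ _).trans (mul_le_mul hsx hp.norm_le_one' (norm_nonneg _) (by positivity))
    have h3 : ‖q * (p - q)‖ ≤ 1 * ‖p - q‖ :=
      (norm_mul_le _ _).trans (mul_le_mul_of_nonneg_right hq.norm_le_one' hn)
    nlinarith

end CloseProjections

/-! ### The inclusion of `A` and the conditional expectation. -/

section Crossed

namespace CrossedProduct

theorem norm_act {A G : Type*} [CStarAlgebra A] [Group G] (α : G →* (A ≃⋆ₐ[ℂ] A)) (g : G) (a : A) :
    ‖α g a‖ = ‖a‖ :=
  (NonUnitalStarAlgHom.isometry (α g) (EquivLike.injective (α g))).norm_map_of_map_zero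
    (map_zero _) a

section

variable {A G : Type*} [CStarAlgebra A] [Group G] [Fintype G] [DecidableEq G]
  (α : G →* (A ≃⋆ₐ[ℂ] A))

theorem incl_injective : Function.Injective (incl α) := fun _ _ h =>
  Pi.single_injective (M := fun _ : G => A) 1 (ofCoeff_injective h)

theorem u_mul_incl (g : G) (a : A) : u α g * incl α a = incl α (α g a) * u α g := by
  rw [← u_mul_incl_mul_star_u, mul_assoc, star_u, u_mul, inv_mul_cancel, u_one, mul_one]

theorem incl_mul_mul_incl (a b : A) (x : G → A) :
    incl α a * ofCoeff α x * incl α b = ∑ h, incl α (a * x h * α h b) * u α h := by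
  rw [ofCoeff_eq_sum, Finset.mul_sum, Finset.sum_mul]
  refine Finset.sum_congr rfl fun h _ => ?_
  rw [mul_assoc, mul_assoc, u_mul_incl, map_mul, map_mul]
  simp only [mul_assoc]

end

variable {A G : Type*} [CStarAlgebra A] [PartialOrder A] [StarOrderedRing A] [Group G] [Fintype G]
  [DecidableEq G] (α : G →* (A ≃⋆ₐ[ℂ] A))

theorem isometry_incl : Isometry (incl α) :=
  NonUnitalStarAlgHom.isometry (incl α) (incl_injective α)

theorem norm_incl (a : A) : ‖incl α a‖ = ‖a‖ := by
  simpa using (isometry_incl α).norm_map_of_map_zero (map_zero _) a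

theorem norm_u_le_one (g : G) : ‖u α g‖ ≤ 1 := by
  have h : ‖u α g‖ * ‖u α g‖ ≤ 1 := by
    rw [← CStarRing.norm_star_mul_self, star_u, u_mul, inv_mul_cancel, u_one]
    exact (IsStarProjection.one _).norm_le_one'
  nlinarith [norm_nonneg (u α g)]

/-- The canonical conditional expectation is positive and faithful. -/
theorem coeff_one_nonneg {x : G → A} (hx : 0 ≤ ofCoeff α x) :
    0 ≤ x 1 ∧ (x 1 = 0 → ofCoeff α x = 0) := by
  obtain ⟨c, hc⟩ := CStarAlgebra.nonneg_iff_eq_star_mul_self.1 hx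
  obtain ⟨y, rfl⟩ := ofCoeff_surjective c
  -- The identity coefficient of `c⋆c` is a sum of positive terms, one for each coefficient of `c`;
  -- it vanishes only if all of them do.
  have h1 : x 1 = ∑ t, α t (star (y t⁻¹) * y t⁻¹) := by
    rw [star_ofCoeff, ofCoeff_mul] at hc
    rw [congrFun (ofCoeff_injective hc) 1]
    simp
  have h2 : ∀ t ∈ Finset.univ, 0 ≤ α t (star (y t⁻¹) * y t⁻¹) := fun t _ => by
    rw [map_mul, map_star]
    exact star_mul_self_nonneg _
  refine ⟨h1 ▸ Finset.sum_nonneg h2, fun h => ?_⟩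
  rw [h1, Finset.sum_eq_zero_iff_of_nonneg h2] at h
  have hy : y = (0 : ℂ) • y := by
    funext t
    have h3 := h t⁻¹ (Finset.mem_univ _)
    rw [inv_inv, EmbeddingLike.map_eq_zero_iff, CStarRing.star_mul_self_eq_zero_iff] at h3
    simp [h3]
  rw [hc, hy, ofCoeff_smul, zero_smul, mul_zero]

end CrossedProduct

end Crossed

/-! ### Nonzero positive elements dominate projections of `A`. -/

section Outer

/-- An off-diagonal block `e g y e h` equals `(e g y - y e g) e h`, hence is at most `δ` in norm. A
large compression by `∑ e g` must then come from some diagonal block. -/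
theorem exists_norm_compress_ge {A : Type*} [CStarAlgebra A] {ι : Type*} [Fintype ι] [DecidableEq ι] [Nonempty ι] (y : A)
    {e : ι → A} (he : ∀ g, IsStarProjection (e g)) (hd : ∀ g h, g ≠ h → e g * e h = 0) {δ c : ℝ}
    (hδ : 0 ≤ δ) (hy : ∀ g, ‖e g * y - y * e g‖ ≤ δ)
    (hc : Fintype.card ι * c + Fintype.card ι * (Fintype.card ι * δ) ≤
      ‖(∑ g, e g) * y * (∑ g, e g)‖) :
    ∃ g, c ≤ ‖e g * y * e g‖ := by
  by_contra! hlt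
  have h1 : (∑ g, e g) * y * (∑ g, e g) = ∑ g, (e g * y * e g + ∑ h ∈ Finset.univ.erase g,
      e g * y * e h) := by
    rw [Finset.sum_mul, Finset.sum_mul]
    refine Finset.sum_congr rfl fun g _ => ?_
    rw [Finset.mul_sum, ← Finset.add_sum_erase _ _ (Finset.mem_univ g)]
  have h2 : ∀ g, ‖∑ h ∈ Finset.univ.erase g, e g * y * e h‖ ≤ Fintype.card ι * δ := by
    intro g
    refine (norm_sum_le _ _).trans ?_
    refine (Finset.sum_le_card_nsmul _ _ δ fun h hh => ?_).trans ?_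
    · have : e g * y * e h = (e g * y - y * e g) * e h := by
        rw [sub_mul, mul_assoc y, hd g h (Finset.ne_of_mem_erase hh).symm, mul_zero, sub_zero]
      rw [this]
      calc _ ≤ δ * 1 := (norm_mul_le _ _).trans
            (mul_le_mul (hy g) (he h).norm_le_one' (norm_nonneg _) hδ)
        _ = δ := mul_one _
    · rw [nsmul_eq_mul]
      gcongr
      exact Finset.card_le_univ _
  have h3 : ‖(∑ g, e g) * y * (∑ g, e g)‖ <
      Fintype.card ι * c + Fintype.card ι * (Fintype.card ι * δ) := by
    rw [h1]
    refine (norm_sum_le _ _).trans_lt ?_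
    have := Finset.sum_lt_sum_of_nonempty (s := (Finset.univ : Finset ι))
      (f := fun g => ‖e g * y * e g + ∑ h ∈ Finset.univ.erase g, e g * y * e h‖)
      (g := fun _ => c + Fintype.card ι * δ) Finset.univ_nonempty
      (fun g _ => (norm_add_le _ _).trans_lt (add_lt_add_of_lt_of_le (hlt g) (h2 g)))
    refine this.trans_eq ?_
    rw [Finset.sum_const, nsmul_eq_mul, Finset.card_univ]
    ring
  exact absurd hc (not_le.2 h3)

namespace CrossedProduct

variable {A G : Type*} [CStarAlgebra A] [PartialOrder A] [StarOrderedRing A] [Group G] [Fintype G]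
  [DecidableEq G] (α : G →* (A ≃⋆ₐ[ℂ] A))

/-- Compressing by a Rokhlin projection nearly kills the off-diagonal coefficients of an element
of the crossed product. -/
theorem norm_compress_sub_le (x : G → A) {e : G → A} (he : ∀ g, IsStarProjection (e g))
    (hd : ∀ g h, g ≠ h → e g * e h = 0) {δ : ℝ}
    (hα : ∀ g h, ‖α g (e h) - e (g * h)‖ ≤ δ) (hx : ∀ g h, ‖e g * x h - x h * e g‖ ≤ δ) (g : G) :
    ‖incl α (e g) * ofCoeff α x * incl α (e g) - incl α (e g * x 1 * e g)‖ ≤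
      ∑ h, (1 + ‖x h‖) * δ := by
  have hδ : 0 ≤ δ := (norm_nonneg _).trans (hα 1 1)
  have h1 : incl α (e g) * ofCoeff α x * incl α (e g) - incl α (e g * x 1 * e g) =
      ∑ h, if h = 1 then 0 else incl α (e g * x h * α h (e g)) * u α h := by
    rw [incl_mul_mul_incl, ← Finset.add_sum_erase _ _ (Finset.mem_univ (1 : G)),
      ← Finset.add_sum_erase (a := (1 : G)) (f := fun h => if h = 1 then 0 else _) _
        (Finset.mem_univ (1 : G))]
    simp only [if_true, map_one, StarAlgEquiv.one_apply, u_one, mul_one, add_sub_cancel_left,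
      zero_add]
    refine Finset.sum_congr rfl fun h hh => ?_
    rw [if_neg (Finset.ne_of_mem_erase hh)]
  rw [h1]
  refine (norm_sum_le _ _).trans (Finset.sum_le_sum fun h _ => ?_)
  split_ifs with hh
  · rw [norm_zero]; positivity
  -- For `h ≠ 1`, `α h (e g)` is close to `e (h g)`, which is orthogonal to `e g`; almost commuting
  -- past `x h` makes the term small.
  have h2 : e g * x h * α h (e g) =
      (e g * x h - x h * e g) * e (h * g) + e g * x h * (α h (e g) - e (h * g)) := by
    rw [sub_mul, mul_sub, mul_assoc (x h), hd g (h * g) (by simpa using hh), mul_zero]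
    abel
  calc ‖incl α (e g * x h * α h (e g)) * u α h‖ ≤ ‖e g * x h * α h (e g)‖ * 1 := by
        refine (norm_mul_le _ _).trans ?_
        rw [norm_incl]
        exact mul_le_mul_of_nonneg_left (norm_u_le_one α h) (norm_nonneg _)
    _ ≤ δ * 1 + 1 * ‖x h‖ * δ := by
        rw [mul_one, h2]
        refine (norm_add_le _ _).trans (add_le_add ?_ ?_)
        · exact (norm_mul_le _ _).trans
            (mul_le_mul (hx g h) (he _).norm_le_one' (norm_nonneg _) hδ)
        · refine norm_mul₃_le.trans ?_
          have := (he g).norm_le_one'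
          have := hα h g
          gcongr
    _ = (1 + ‖x h‖) * δ := by ring

/-- Under the tracial Rokhlin property every nonzero positive element of the crossed product
dominates, in the sense of Cuntz, a nonzero projection of `A`. -/
theorem exists_projection_of_nonneg (hrr : HasRealRankZero A) (hα : HasTracialRokhlinProperty α)
    {z : CrossedProduct α} (hz : 0 ≤ z) (hz0 : z ≠ 0) :
    ∃ P : A, IsStarProjection P ∧ P ≠ 0 ∧ ∃ y : CrossedProduct α,
      star (z * y) * (z * y) = incl α P := by
  classical
  obtain ⟨x, rfl⟩ := ofCoeff_surjective z
  obtain ⟨hx0, hx1⟩ := coeff_one_nonneg α hz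
  have hm : 0 < ‖x 1‖ := norm_pos_iff.2 fun h => hz0 (hx1 h)
  set m := ‖x 1‖ with hmdef
  have hn : (0 : ℝ) < Fintype.card G := by exact_mod_cast Fintype.card_pos
  set n : ℝ := (Fintype.card G : ℝ) with hndef
  set C : ℝ := ∑ h, (1 + ‖x h‖) with hC
  have hC0 : 0 < C := Finset.sum_pos (fun h _ => by positivity) Finset.univ_nonempty
  set c := m / (2 * n) with hc
  have hc0 : 0 < c := by positivity
  -- The first two bounds give `n c + n² δ ≤ 3m/4 ≤ (1 - δ) m`, so some block has norm at least `c`.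
  -- The third makes the off-diagonal error at most `c/4`, below the `c/3` obtained from real rank
  -- zero; `κ = c/3 - c/4`.
  set δ := min (1 / 4) (min (m / (4 * n ^ 2)) (c / (4 * C))) with hδ
  have hδ0 : 0 < δ := by positivity
  have hδ1 : δ ≤ 1 / 4 := min_le_left _ _
  have hδ2 : n * (n * δ) ≤ m / 4 := by
    have : δ ≤ m / (4 * n ^ 2) := (min_le_right _ _).trans (min_le_left _ _)
    rw [le_div_iff₀ (by positivity)] at this
    linarith
  have hδ3 : C * δ ≤ c / 4 := by
    have : δ ≤ c / (4 * C) := (min_le_right _ _).trans (min_le_right _ _)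
    rw [le_div_iff₀ (by positivity)] at this
    linarith
  obtain ⟨e, he, hd, hαe, hcomm, -, hnorm⟩ := hα (Finset.univ.image x) δ hδ0 (m⁻¹ • x 1)
    (smul_nonneg (by positivity) hx0) (by
      rw [norm_smul, norm_inv, Real.norm_of_nonneg hm.le, inv_mul_cancel₀ hm.ne'])
  have hcomm' : ∀ g h, ‖e g * x h - x h * e g‖ ≤ δ := fun g h =>
    (hcomm g (x h) (Finset.mem_image_of_mem _ (Finset.mem_univ h))).le
  obtain ⟨g, hg⟩ : ∃ g, c ≤ ‖e g * x 1 * e g‖ := by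
    refine exists_norm_compress_ge (x 1) he hd hδ0.le (fun g => hcomm' g 1) ?_
    rw [mul_smul_comm, smul_mul_assoc, norm_smul, norm_inv, Real.norm_of_nonneg hm.le,
      inv_mul_eq_div, lt_div_iff₀ hm] at hnorm
    refine le_trans ?_ hnorm.le
    have h1 : n * c = m / 2 := by rw [hc]; field_simp
    rw [← hndef, h1]
    nlinarith
  have hE := norm_compress_sub_le α x he hd (fun g h => (hαe g h).le) hcomm' g
  rw [← Finset.sum_mul, ← hC] at hE
  set z := ofCoeff α x
  set r := e g with hr
  have hrp : IsStarProjection r := he g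
  have hirp : IsStarProjection (incl α r) := hrp.map (incl α)
  have hy0 : 0 ≤ r * x 1 * r := by simpa using hrp.conj_mono hx0
  obtain ⟨P, hP, hP0, hle⟩ := hrr.exists_projection_smul_le hy0
    (norm_pos_iff.1 (hc0.trans_le hg))
  have hQ : IsStarProjection (incl α P) := hP.map (incl α)
  set Q := incl α P with hQdef
  have hle' : (c / 3) • Q ≤ Q * incl α (r * x 1 * r) * Q := by
    have h1 : (c / 3) • P ≤ P * (r * x 1 * r) * P :=
      (smul_le_smul_of_nonneg_right (by linarith) hP.nonneg).trans hle
    have h2 : incl α ((c / 3) • P) ≤ incl α (P * (r * x 1 * r) * P) := by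
      rw [← sub_nonneg, ← map_sub]
      exact map_nonneg (incl α) (sub_nonneg.2 h1)
    have h3 : incl α ((c / 3) • P) = (c / 3) • Q := by
      rw [← Complex.coe_smul, map_smul, Complex.coe_smul]
    rwa [h3, map_mul, map_mul] at h2
  set κ := c / 12 with hκ
  have hκ0 : 0 < κ := by positivity
  have hsz : IsSelfAdjoint z := .of_nonneg hz
  have hlow : κ • Q ≤ Q * (incl α r * z * incl α r) * Q := by
    set E := incl α r * z * incl α r - incl α (r * x 1 * r) with hEdef
    have hsE : IsSelfAdjoint E := by
      refine IsSelfAdjoint.sub ?_ ((IsSelfAdjoint.of_nonneg hy0).map (incl α))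
      simpa [hirp.isSelfAdjoint.star_eq] using hsz.conjugate (incl α r)
    have h1 := hQ.conj_mono (neg_smul_one_le hsE (hE.trans hδ3))
    have h2 : Q * -((c / 4) • 1) * Q = -((c / 4) • Q) := by
      rw [mul_neg, neg_mul, mul_smul_comm, mul_one, smul_mul_assoc, hQ.isIdempotentElem.eq]
    rw [h2] at h1
    have h3 : incl α r * z * incl α r = incl α (r * x 1 * r) + E := by rw [hEdef]; abel
    rw [h3, mul_add, add_mul]
    refine le_trans (le_of_eq ?_) (add_le_add hle' h1)
    rw [← sub_eq_add_neg, ← sub_smul]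
    congr 1
    rw [hκ]; ring
  -- Expanding `(z - κ)² ≥ 0` converts the lower bound on the compression of `z` into one on that of
  -- `z²`, which is what `(z y)⋆(z y)` requires.
  have hsq : (2 * κ) • z ≤ z * z + (κ ^ 2) • (1 : CrossedProduct α) := by
    have h1 : 0 ≤ star (z - κ • (1 : CrossedProduct α)) * (z - κ • (1 : CrossedProduct α)) :=
      star_mul_self_nonneg _
    have h2 : star (z - κ • (1 : CrossedProduct α)) = z - κ • (1 : CrossedProduct α) :=
      hsz.sub ((IsSelfAdjoint.all κ).smul (.one _))
    rw [h2, sub_mul, mul_sub, mul_sub, mul_smul_comm, smul_mul_smul_comm, smul_mul_assoc, mul_one,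
      mul_one, one_mul] at h1
    rw [← sub_nonneg]
    convert h1 using 1
    module
  have hfin : κ ^ 2 • Q ≤ star (z * incl α r * Q) * (z * incl α r * Q) := by
    have h1 := hQ.conj_mono (hirp.conj_mono hsq)
    have h2 : Q * incl α r * Q ≤ Q := by
      have h0 : incl α r ≤ 1 := by
        rw [← sub_nonneg]
        exact hirp.one_sub.nonneg
      have := hQ.conj_mono h0
      rwa [mul_one, hQ.isIdempotentElem.eq] at this
    have h3 : Q * (incl α r * ((2 * κ) • z) * incl α r) * Q =
        (2 * κ) • (Q * (incl α r * z * incl α r) * Q) := by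
      simp only [mul_smul_comm, smul_mul_assoc]
    have h4 : Q * (incl α r * (z * z + (κ ^ 2) • (1 : CrossedProduct α)) * incl α r) * Q =
        star (z * incl α r * Q) * (z * incl α r * Q) + κ ^ 2 • (Q * incl α r * Q) := by
      rw [mul_add, add_mul, mul_smul_comm, mul_one, smul_mul_assoc, hirp.isIdempotentElem.eq,
        mul_add, add_mul, mul_smul_comm, smul_mul_assoc]
      congr 1
      simp only [star_mul, hsz.star_eq, hirp.isSelfAdjoint.star_eq, hQ.isSelfAdjoint.star_eq,
        mul_assoc]
    rw [h3, h4] at h1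
    have h5 : (2 * κ) • κ • Q ≤ (2 * κ) • (Q * (incl α r * z * incl α r) * Q) :=
      smul_le_smul_of_nonneg_left hlow (by positivity)
    have h6 : κ ^ 2 • (Q * incl α r * Q) ≤ κ ^ 2 • Q :=
      smul_le_smul_of_nonneg_left h2 (by positivity)
    have h7 := h5.trans (h1.trans (add_le_add_right h6 _))
    rw [← sub_le_iff_le_add] at h7
    refine le_trans (le_of_eq ?_) h7
    module
  obtain ⟨y, -, hy⟩ := exists_star_mul_self_eq_of_smul_le hQ
    (by rw [mul_assoc, hQ.isIdempotentElem.eq]) (by positivity) hfin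
  exact ⟨P, hP, hP0, incl α r * Q * y, by simpa only [mul_assoc] using hy⟩

end CrossedProduct

end Outer

noncomputable section

/-! ### Matrix algebras over a corner, built from isometries. -/

section MatrixHom

variable {A C G : Type*} [CStarAlgebra A] [CStarAlgebra C] [Fintype G] [DecidableEq G]

/-- A family of isometries on the corner of `f` with orthogonal ranges yields a copy of
`M_n ⊗ f A f`. -/
def cornerMatrixHom (π : A →⋆ₐ[ℂ] C) {f : A} (hf : IsStarProjection f) (v : G → C)
    (hv : ∀ g h, star (v g) * v h = if g = h then π f else 0) :
    Matrix G G (corner f hf) →⋆ₙₐ[ℂ] C where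
  toFun M := ∑ g, ∑ h, v g * π (M g h : A) * star (v h)
  map_smul' c M := by
    simp only [Matrix.smul_apply, NonUnitalStarSubalgebra.coe_smul, map_smul, mul_smul_comm,
      smul_mul_assoc, Finset.smul_sum, MonoidHom.id_apply]
  map_zero' := by simp
  map_add' M M' := by
    simp only [Matrix.add_apply, NonUnitalStarSubalgebra.coe_add, map_add, mul_add, add_mul,
      Finset.sum_add_distrib]
  map_mul' M M' := by
    have key : ∀ g l, v g * π (M g l : A) * star (v l) *
        (∑ k, ∑ h, v k * π (M' k h : A) * star (v h)) =
          ∑ h, v g * (π (M g l : A) * π (M' l h : A)) * star (v h) := by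
      intro g l
      have h1 : π (M g l : A) * π f = π (M g l : A) := by
        have : (M g l : A) * f = M g l := by
          have h2 : f * (M g l : A) * f = M g l := (M g l).2
          rw [← h2, mul_assoc, hf.isIdempotentElem.eq]
        rw [← map_mul, this]
      rw [Finset.mul_sum, Finset.sum_eq_single l]
      · rw [Finset.mul_sum]
        refine Finset.sum_congr rfl fun h _ => ?_
        calc _ = v g * (π (M g l : A) * (star (v l) * v l) * π (M' l h : A)) * star (v h) := by
              simp only [mul_assoc]
          _ = _ := by rw [hv, if_pos rfl, h1]
      · intro k _ hk
        have h2 : star (v l) * v k = 0 := by rw [hv, if_neg hk.symm]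
        rw [Finset.mul_sum]
        refine Finset.sum_eq_zero fun h _ => ?_
        calc _ = v g * π (M g l : A) * (star (v l) * v k) * (π (M' k h : A) * star (v h)) := by
              simp only [mul_assoc]
          _ = 0 := by rw [h2, mul_zero, zero_mul]
      · exact fun h => absurd (Finset.mem_univ _) h
    rw [Finset.sum_mul]
    refine Finset.sum_congr rfl fun g _ => ?_
    rw [Finset.sum_mul, Finset.sum_congr rfl fun l _ => key g l, Finset.sum_comm]
    refine Finset.sum_congr rfl fun h _ => ?_
    simp only [Matrix.mul_apply, AddSubmonoidClass.coe_finsetSum, NonUnitalStarSubalgebra.coe_mul,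
      map_sum, map_mul, Finset.mul_sum, Finset.sum_mul]
  map_star' M := by
    have hs : ∀ a : corner f hf, π ((star a : corner f hf) : A) = star (π (a : A)) := fun a =>
      map_star π (a : A)
    simp only [Matrix.star_apply, hs, star_sum, star_mul, star_star, mul_assoc]
    exact Finset.sum_comm

variable {π : A →⋆ₐ[ℂ] C} {f : A} {hf : IsStarProjection f} {v : G → C}
  {hv : ∀ g h, star (v g) * v h = if g = h then π f else 0}

theorem cornerMatrixHom_apply (M : Matrix G G (corner f hf)) :
    cornerMatrixHom π hf v hv M = ∑ g, ∑ h, v g * π (M g h : A) * star (v h) := rfl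

theorem cornerMatrixHom_single (g h : G) (a : corner f hf) :
    cornerMatrixHom π hf v hv (Matrix.single g h a) = v g * π (a : A) * star (v h) := by
  rw [cornerMatrixHom_apply, Finset.sum_eq_single g, Finset.sum_eq_single h]
  · simp
  · intro k _ hk
    simp [Matrix.single_apply_of_col_ne g g hk.symm]
  · simp
  · intro k _ hk
    refine Finset.sum_eq_zero fun l _ => ?_
    simp [Matrix.single_apply_of_row_ne hk.symm]
  · simp

/-- The entries are recovered by compression with the `v g`; injectivity and the description of the
range both rest on this. -/
theorem star_mul_cornerMatrixHom_mul (M : Matrix G G (corner f hf)) (g h : G) :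
    star (v g) * cornerMatrixHom π hf v hv M * v h = π (M g h : A) := by
  rw [cornerMatrixHom_apply, Finset.mul_sum, Finset.sum_mul, Finset.sum_eq_single g,
    Finset.mul_sum, Finset.sum_mul, Finset.sum_eq_single h]
  · calc _ = (star (v g) * v g) * π (M g h : A) * (star (v h) * v h) := by simp only [mul_assoc]
      _ = π (M g h : A) := by
        rw [hv, hv, if_pos rfl, if_pos rfl, ← map_mul, ← map_mul]
        exact congrArg π (M g h).2
  · intro k _ hk
    calc _ = star (v g) * v g * π (M g k : A) * (star (v k) * v h) := by simp only [mul_assoc]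
      _ = 0 := by rw [hv k h, if_neg hk, mul_zero]
  · simp
  · intro k _ hk
    have : star (v g) * v k = 0 := by rw [hv, if_neg hk.symm]
    simp only [Finset.mul_sum, Finset.sum_mul]
    refine Finset.sum_eq_zero fun l _ => ?_
    simp only [← mul_assoc, this, zero_mul]
  · simp

theorem cornerMatrixHom_injective (hπ : Function.Injective π) :
    Function.Injective (cornerMatrixHom π hf v hv) := by
  intro M M' h
  ext g k
  refine hπ ?_
  rw [← star_mul_cornerMatrixHom_mul (hv := hv), ← star_mul_cornerMatrixHom_mul (hv := hv), h]

/-- No corner condition on `a` is needed: `v g = v g π(f)` replaces `a` by `f a f`. -/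
theorem mul_mul_star_mem_range (a : A) (g h : G) :
    v g * π a * star (v h) ∈ NonUnitalStarAlgHom.range (cornerMatrixHom π hf v hv) := by
  have ff : f * f = f := hf.isIdempotentElem
  have hfaf : f * a * f ∈ corner f hf := by
    change f * (f * a * f) * f = f * a * f
    simp only [← mul_assoc, ff]
    simp only [mul_assoc, ff]
  refine ⟨Matrix.single g h ⟨f * a * f, hfaf⟩, ?_⟩
  refine (cornerMatrixHom_single (hv := hv) g h _).trans ?_
  have hvf : ∀ k, v k * π f = v k := fun k =>
    mul_eq_self_of_star_mul_self (hf.map π) (by rw [hv, if_pos rfl])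
  have h2 : π f * star (v h) = star (v h) := by
    rw [← star_inj, star_mul, star_star, (hf.map π).isSelfAdjoint.star_eq, hvf]
  calc v g * π (f * a * f) * star (v h) = (v g * π f) * π a * (π f * star (v h)) := by
        simp only [map_mul, mul_assoc]
    _ = _ := by rw [hvf, h2]

theorem mem_range_cornerMatrixHom_iff (c : C) :
    c ∈ NonUnitalStarAlgHom.range (cornerMatrixHom π hf v hv) ↔
      (∑ g, v g * star (v g)) * c * (∑ g, v g * star (v g)) = c ∧
        ∀ g h, star (v g) * c * v h ∈ Set.range π := by
  have hsum : (∑ g, v g * star (v g)) * c * (∑ g, v g * star (v g)) =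
      ∑ g, ∑ h, v g * (star (v g) * c * v h) * star (v h) := by
    rw [Finset.sum_mul, Finset.sum_mul]
    refine Finset.sum_congr rfl fun g _ => ?_
    rw [Finset.mul_sum]
    refine Finset.sum_congr rfl fun h _ => ?_
    simp only [mul_assoc]
  constructor
  · rintro ⟨M, rfl⟩
    refine ⟨?_, fun g h => ⟨M g h, (star_mul_cornerMatrixHom_mul (hv := hv) M g h).symm⟩⟩
    rw [hsum]
    refine Eq.trans ?_ (cornerMatrixHom_apply (hv := hv) M).symm
    refine Finset.sum_congr rfl fun g _ => Finset.sum_congr rfl fun h _ => ?_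
    exact congrArg (fun t => v g * t * star (v h)) (star_mul_cornerMatrixHom_mul (hv := hv) M g h)
  · rintro ⟨h1, h2⟩
    rw [← h1, hsum]
    refine sum_mem fun g _ => sum_mem fun h _ => ?_
    obtain ⟨a, ha⟩ := h2 g h
    rw [← ha]
    exact mul_mul_star_mem_range a g h

/-- The range is cut out by closed conditions: an injective ⋆-homomorphism is isometric, so the
image of `π` is closed. -/
theorem isClosed_range_cornerMatrixHom (hπ : Function.Injective π) :
    IsClosed (NonUnitalStarAlgHom.range (cornerMatrixHom π hf v hv) : Set C) := by
  have hcl : IsClosed (Set.range π) :=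
    (NonUnitalStarAlgHom.isometry π hπ).isClosedEmbedding.isClosed_range
  have : (NonUnitalStarAlgHom.range (cornerMatrixHom π hf v hv) : Set C) =
      {c | (∑ g, v g * star (v g)) * c * (∑ g, v g * star (v g)) = c} ∩
        ⋂ (g : G) (h : G), {c | star (v g) * c * v h ∈ Set.range π} := by
    ext c
    simp only [SetLike.mem_coe, mem_range_cornerMatrixHom_iff, Set.mem_inter_iff, Set.mem_iInter,
      Set.mem_ofPred_eq]
  rw [this]
  refine IsClosed.inter (isClosed_eq (by fun_prop) continuous_id) ?_
  exact isClosed_iInter fun g => isClosed_iInter fun h => hcl.preimage (by fun_prop)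

end MatrixHom

/-! ### Orthogonal diagonal copies of the complement. -/

section Copies

variable {A : Type*} [CStarAlgebra A] [PartialOrder A] [StarOrderedRing A]

/-- If the complement of `∑ e g` has small trace, then `∑ e g` contains `N` orthogonal copies of it
which are diagonal with respect to the `e g`. -/
theorem exists_diagonal_copies (hrr : HasRealRankZero A) (hord : OrderDeterminedByTraces A)
    {ι : Type*} [Fintype ι] [DecidableEq ι] {e : ι → A} (he : ∀ g, IsStarProjection (e g))
    (hd : ∀ g h, g ≠ h → e g * e h = 0) (N : ℕ)
    (hτ : ∀ τ : A →L[ℂ] ℂ, IsTracialState τ → (N + 1) * (τ (1 - ∑ g, e g)).re < 1) :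
    ∃ r : Fin N → ι → A, (∀ i g, IsStarProjection (r i g)) ∧ (∀ i g, e g * r i g = r i g) ∧
      (∀ i j, i ≠ j → ∀ g, r i g * r j g = 0) ∧ ∀ i, MvNEquiv (1 - ∑ g, e g) (∑ g, r i g) := by
  have hE : IsStarProjection (∑ g, e g) :=
    IsStarProjection.finset_sum _ (fun g _ => he g) fun g _ h _ => hd g h
  induction N with
  | zero => exact ⟨Fin.elim0, fun i => i.elim0, fun i => i.elim0, fun i => i.elim0, fun i => i.elim0⟩
  | succ N ih =>
    obtain ⟨r, hr, her, hrd, hre⟩ := ih fun τ h => by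
      have h1 := hτ τ h
      have h2 := h.re_nonneg hE.one_sub
      push_cast at h1
      nlinarith
    have hrsum : ∀ g, IsStarProjection (∑ i, r i g) := fun g =>
      IsStarProjection.finset_sum _ (fun i _ => hr i g) fun i _ j _ hij => hrd i j hij g
    have hesum : ∀ g, e g * ∑ i, r i g = ∑ i, r i g := fun g => by
      rw [Finset.mul_sum]
      exact Finset.sum_congr rfl fun i _ => her i g
    -- Remove the `N` copies already found from each block. If `t` is the trace of the complement,
    -- the remainder has trace `1 - (N + 1) t`, which exceeds `t` because `(N + 2) t < 1`.
    set e' : ι → A := fun g => e g - ∑ i, r i g with he'def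
    have he' : ∀ g, IsStarProjection (e' g) := fun g =>
      (hrsum g).sub_of_mul_eq_right (he g) (hesum g)
    have hee' : ∀ g, e g * e' g = e' g := fun g => by
      rw [he'def, mul_sub, (he g).isIdempotentElem.eq, hesum]
    have hd' : ∀ g h, g ≠ h → e' g * e' h = 0 := fun g h hgh => by
      rw [← hee' h, ← ((he g).mul_eq_comm (he' g)).1 (hee' g), mul_assoc, ← mul_assoc (e g),
        hd g h hgh, zero_mul, mul_zero]
    have hsub : MvNSubequiv (1 - ∑ g, e g) (∑ g, e' g) := by
      refine hord.mvNSubequiv hE.one_sub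
        (IsStarProjection.finset_sum _ (fun g _ => he' g) fun g _ h _ => hd' g h) fun τ h => ?_
      have h1 : ∑ g, e' g = 1 - (1 - ∑ g, e g) - ∑ i, ∑ g, r i g := by
        rw [he'def, Finset.sum_sub_distrib, Finset.sum_comm]
        abel
      have h2 : τ (∑ i, ∑ g, r i g) = N * τ (1 - ∑ g, e g) := by
        rw [map_sum, Finset.sum_congr rfl fun i _ => (h.eq_of_mvNEquiv (hre i)).symm,
          Finset.sum_const, Finset.card_univ, Fintype.card_fin, nsmul_eq_mul]
      have hre' : ∀ c : ℂ, ((N : ℂ) * c).re = N * c.re := fun c => by simp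
      have h3 := hτ τ h
      rw [h1, map_sub τ (1 - (1 - ∑ g, e g)), h2, map_sub τ 1 (1 - ∑ g, e g), h.map_one]
      simp only [Complex.sub_re, Complex.one_re, hre']
      push_cast at h3
      linarith
    obtain ⟨s, hs, hs1, hs2⟩ := hsub
    -- Comparison by traces gives a copy with no relation to the blocks; Riesz decomposition makes
    -- it diagonal.
    obtain ⟨t, ht, het, hst⟩ := hrr.exists_mvNEquiv_sum he' hd' Finset.univ hs hs1
    have hortho : ∀ i g, r i g * t g = 0 := fun i g => by
      have h1 : r i g * ∑ j, r j g = r i g := by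
        rw [Finset.mul_sum, Finset.sum_eq_single i (fun j _ h => hrd i j h.symm g) (by simp),
          (hr i g).isIdempotentElem.eq]
      rw [← het g, ← mul_assoc, he'def, mul_sub, h1, ((he g).mul_eq_comm (hr i g)).1 (her i g),
        sub_self, zero_mul]
    have htsum : IsStarProjection (∑ g, t g) :=
      IsStarProjection.finset_sum _ (fun g _ => ht g) fun g _ h _ hgh => by
        rw [← het h, ← ((he' g).mul_eq_comm (ht g)).1 (het g), mul_assoc, ← mul_assoc (e' g),
          hd' g h hgh, zero_mul, mul_zero]
    refine ⟨Fin.cons t r, ?_, ?_, ?_, ?_⟩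
    · exact Fin.cases (by simpa using ht) (by simpa using hr)
    · refine Fin.cases (fun g => ?_) (by simpa using her)
      rw [Fin.cons_zero, ← het g, ← mul_assoc, hee']
    · refine Fin.cases (Fin.cases (fun h => absurd rfl h) fun j _ g => ?_)
        fun i => Fin.cases (fun _ g => ?_) fun j hij g => ?_
      · rw [Fin.cons_zero, Fin.cons_succ]
        exact ((hr j g).mul_eq_zero_comm (ht g)).1 (hortho j g)
      · rw [Fin.cons_zero, Fin.cons_succ]
        exact hortho i g
      · rw [Fin.cons_succ, Fin.cons_succ]
        exact hrd i j (fun h => hij (by rw [h])) g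
    · refine Fin.cases ?_ (by simpa using hre)
      rw [Fin.cons_zero]
      exact hs2.trans hE.one_sub htsum hst

end Copies

end

noncomputable section

/-! ### Isometries from Rokhlin projections. -/

section RokhlinIsometries

namespace CrossedProduct

variable {A G : Type*} [CStarAlgebra A] [Group G] [Fintype G] [DecidableEq G]
  {α : G →* (A ≃⋆ₐ[ℂ] A)}

variable (α) in
/-- The partial isometries `u g w_g⋆` of the crossed product, for `w : G → A`. -/
def rokhlinIsometry (w : G → A) (g : G) : CrossedProduct α := u α g * incl α (star (w g))

/-- By covariance, conjugation with these elements preserves `A`; this is why the diagonal matrix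
blocks land in `A` and can be compared with `α g`. -/
theorem rokhlinIsometry_mul_incl_mul_star (w : G → A) (g : G) (a : A) :
    rokhlinIsometry α w g * incl α a * star (rokhlinIsometry α w g) =
      incl α (α g (star (w g) * a * w g)) := by
  rw [← u_mul_incl_mul_star_u, rokhlinIsometry, map_mul, map_mul]
  simp only [star_mul, map_star, star_star, mul_assoc]

theorem star_incl_mul_rokhlinIsometry (w : G → A) (g : G) (a : A) :
    star (rokhlinIsometry α w g) * incl α a * rokhlinIsometry α w g =
      incl α (w g * α g⁻¹ a * star (w g)) := by
  have h := u_mul_incl_mul_star_u α g⁻¹ a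
  rw [star_u, inv_inv] at h
  rw [map_mul, map_mul, ← h, rokhlinIsometry]
  simp only [star_mul, map_star, star_star, star_u, mul_assoc]

theorem rokhlinIsometry_mul_star {e w : G → A} (hw : ∀ g, star (w g) * w g = α g⁻¹ (e g)) (g : G) :
    rokhlinIsometry α w g * star (rokhlinIsometry α w g) = incl α (e g) := by
  have h := rokhlinIsometry_mul_incl_mul_star (α := α) w g 1
  rwa [map_one, mul_one, mul_one, hw, act_act, mul_inv_cancel, map_one, StarAlgEquiv.one_apply] at h

theorem star_rokhlinIsometry_mul_self {e w : G → A} (hw' : ∀ g, w g * star (w g) = e 1) (g : G) :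
    star (rokhlinIsometry α w g) * rokhlinIsometry α w g = incl α (e 1) := by
  have h := star_incl_mul_rokhlinIsometry (α := α) w g 1
  rwa [map_one, mul_one, map_one, mul_one, hw'] at h

end CrossedProduct

end RokhlinIsometries

/-! ### Approximation of the crossed product by the matrix algebra. -/

section Approximation

namespace CrossedProduct

variable {A G : Type*} [CStarAlgebra A] [PartialOrder A] [StarOrderedRing A] [Group G] [Fintype G]
  [DecidableEq G] {α : G →* (A ≃⋆ₐ[ℂ] A)} {e w : G → A} (he : ∀ g, IsStarProjection (e g))
  (hw : ∀ g, star (w g) * w g = α g⁻¹ (e g)) (hw' : ∀ g, w g * star (w g) = e 1)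

include he hw in
theorem incl_mul_rokhlinIsometry (g : G) :
    incl α (e g) * rokhlinIsometry α w g = rokhlinIsometry α w g :=
  mul_eq_self_of_mul_star_self ((he g).map (incl α)) (rokhlinIsometry_mul_star hw g)

include he hw hw' in
theorem star_rokhlinIsometry_mul (hd : ∀ g h, g ≠ h → e g * e h = 0) (g h : G) :
    star (rokhlinIsometry α w g) * rokhlinIsometry α w h = if g = h then incl α (e 1) else 0 := by
  split_ifs with hgh
  · subst hgh
    exact star_rokhlinIsometry_mul_self hw' g
  · rw [← incl_mul_rokhlinIsometry he hw g, ← incl_mul_rokhlinIsometry he hw h, star_mul,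
      ((he g).map (incl α)).isSelfAdjoint.star_eq, mul_assoc, ← mul_assoc (incl α (e g)),
      ← map_mul, hd g h hgh, map_zero, zero_mul, mul_zero]

include he in
theorem norm_rokhlinIsometry_sub_le {η : ℝ} (hη : ∀ g, ‖w g - e 1‖ ≤ η) (g : G) :
    ‖rokhlinIsometry α w g - u α g * incl α (e 1)‖ ≤ η := by
  have h : rokhlinIsometry α w g - u α g * incl α (e 1) = u α g * incl α (star (w g - e 1)) := by
    rw [rokhlinIsometry, ← mul_sub, ← map_sub, star_sub, (he 1).isSelfAdjoint.star_eq]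
  rw [h]
  calc _ ≤ 1 * ‖incl α (star (w g - e 1))‖ :=
        (norm_mul_le _ _).trans (mul_le_mul_of_nonneg_right (norm_u_le_one α g) (norm_nonneg _))
    _ ≤ η := by rw [one_mul, norm_incl, norm_star]; exact hη g

include he hw' in
theorem norm_rokhlinIsometry_le_one (g : G) : ‖rokhlinIsometry α w g‖ ≤ 1 := by
  have h : ‖rokhlinIsometry α w g‖ * ‖rokhlinIsometry α w g‖ ≤ 1 := by
    rw [← CStarRing.norm_star_mul_self, star_rokhlinIsometry_mul_self hw', norm_incl]
    exact (he 1).norm_le_one'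
  nlinarith [norm_nonneg (rokhlinIsometry α w g)]

include he hw' in
-- With `k = h⁻¹ g`, replacing `v g` and `v k` by `u g e₁` and `u k e₁` costs `η` each. The product
-- becomes `α g (e₁) u h`, which is within `δ` of `e g u h`.
theorem norm_incl_mul_u_sub_le {δ η : ℝ} (hα : ∀ g h, ‖α g (e h) - e (g * h)‖ ≤ δ)
    (hη : ∀ g, ‖w g - e 1‖ ≤ η) (g h : G) :
    ‖incl α (e g) * u α h - rokhlinIsometry α w g * star (rokhlinIsometry α w (h⁻¹ * g))‖ ≤
      δ + 2 * η := by
  set v := rokhlinIsometry α w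
  set k := h⁻¹ * g with hk
  have hη0 : 0 ≤ η := (norm_nonneg _).trans (hη 1)
  have hfs : star (incl α (e 1)) = incl α (e 1) := ((he 1).map (incl α)).isSelfAdjoint
  have h1 : (u α g * incl α (e 1)) * star (u α k * incl α (e 1)) =
      incl α (α g (e 1)) * u α h := by
    rw [star_mul, hfs, star_u, mul_assoc, ← mul_assoc (incl α (e 1)), ← map_mul,
      (he 1).isIdempotentElem.eq, ← mul_assoc, u_mul_incl, mul_assoc, u_mul, hk]
    congr 2
    group
  have h2 : incl α (e g) * u α h - v g * star (v k) =
      incl α (e g - α g (e 1)) * u α h + (u α g * incl α (e 1) - v g) * star (u α k * incl α (e 1))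
        + v g * star (u α k * incl α (e 1) - v k) := by
    rw [map_sub, sub_mul, sub_mul, star_sub, mul_sub, h1]
    abel
  have h3 := norm_rokhlinIsometry_sub_le (α := α) he hη
  have n1 : ‖incl α (e g - α g (e 1)) * u α h‖ ≤ δ * 1 := by
    refine (norm_mul_le _ _).trans (mul_le_mul ?_ (norm_u_le_one α h) (norm_nonneg _)
      ((norm_nonneg _).trans (hα 1 1)))
    rw [norm_incl, norm_sub_rev]
    simpa using hα g 1
  have n2 : ‖u α k * incl α (e 1)‖ ≤ 1 * 1 := by
    refine (norm_mul_le _ _).trans (mul_le_mul (norm_u_le_one α k) ?_ (norm_nonneg _) zero_le_one)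
    rw [norm_incl]
    exact (he 1).norm_le_one'
  have n3 : ‖(u α g * incl α (e 1) - v g) * star (u α k * incl α (e 1))‖ ≤ η * 1 := by
    refine (norm_mul_le _ _).trans (mul_le_mul ?_ ?_ (norm_nonneg _) hη0)
    · rw [norm_sub_rev]; exact h3 g
    · rw [norm_star]; simpa using n2
  have n4 : ‖v g * star (u α k * incl α (e 1) - v k)‖ ≤ 1 * η := by
    refine (norm_mul_le _ _).trans (mul_le_mul (norm_rokhlinIsometry_le_one he hw' g) ?_
      (norm_nonneg _) zero_le_one)
    rw [norm_star, norm_sub_rev]; exact h3 k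
  rw [h2]
  refine (norm_add₃_le).trans ?_
  linarith

include he hw' in
-- In `e g x h u h`, duplicate `e g` and move one copy past `x h`, at cost `δ`; then replace `e g u
-- h` by `v g v_{h⁻¹g}⋆`. The approximant is a diagonal element of `A` times matrix units.
theorem norm_incl_sum_mul_sub_le {δ η : ℝ} (hα : ∀ g h, ‖α g (e h) - e (g * h)‖ ≤ δ)
    (hη : ∀ g, ‖w g - e 1‖ ≤ η) (x : G → A) (hx : ∀ g h, ‖e g * x h - x h * e g‖ ≤ δ) :
    ‖incl α (∑ g, e g) * ofCoeff α x - ∑ h, ∑ g, incl α (e g * x h * e g) *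
        (rokhlinIsometry α w g * star (rokhlinIsometry α w (h⁻¹ * g)))‖ ≤
      ∑ h, Fintype.card G * (δ + ‖x h‖ * (δ + 2 * η)) := by
  rw [ofCoeff_eq_sum, map_sum, Finset.mul_sum, ← Finset.sum_sub_distrib]
  refine (norm_sum_le _ _).trans (Finset.sum_le_sum fun h _ => ?_)
  rw [Finset.sum_mul, ← Finset.sum_sub_distrib]
  refine (norm_sum_le_of_le (f := fun g => _) Finset.univ
    (n := fun _ => δ + ‖x h‖ * (δ + 2 * η)) fun g _ => ?_).trans_eq (by simp [mul_add])
  have h1 : incl α (e g) * (incl α (x h) * u α h) - incl α (e g * x h * e g) *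
      (rokhlinIsometry α w g * star (rokhlinIsometry α w (h⁻¹ * g))) =
      incl α (e g * (e g * x h - x h * e g)) * u α h + incl α (e g * x h * e g) *
        (incl α (e g) * u α h - rokhlinIsometry α w g * star (rokhlinIsometry α w (h⁻¹ * g))) := by
    rw [mul_sub (incl α (e g * x h * e g)), ← mul_assoc (incl α (e g * x h * e g)) (incl α (e g)),
      ← map_mul, mul_assoc (e g * x h) (e g), (he g).isIdempotentElem.eq, mul_sub,
      ← mul_assoc (e g) (e g), (he g).isIdempotentElem.eq, map_sub, sub_mul, ← mul_assoc (e g),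
      ← mul_assoc (incl α (e g)), ← map_mul]
    abel
  have hδ : 0 ≤ δ := (norm_nonneg _).trans (hα 1 1)
  have heg := (he g).norm_le_one'
  rw [h1]
  refine (norm_add_le _ _).trans (add_le_add ?_ ?_)
  · calc _ ≤ (1 * δ) * 1 := by
          refine (norm_mul_le _ _).trans (mul_le_mul ?_ (norm_u_le_one α h) (norm_nonneg _)
            (by positivity))
          rw [norm_incl]
          exact (norm_mul_le _ _).trans (mul_le_mul heg (hx g h) (norm_nonneg _) zero_le_one)
      _ = δ := by ring
  · refine (norm_mul_le _ _).trans (mul_le_mul ?_ (norm_incl_mul_u_sub_le he hw' hα hη g h)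
      (norm_nonneg _) (norm_nonneg _))
    rw [norm_incl]
    calc ‖e g * x h * e g‖ ≤ ‖e g‖ * ‖x h‖ * ‖e g‖ := norm_mul₃_le
      _ ≤ 1 * ‖x h‖ * 1 := by gcongr
      _ = ‖x h‖ := by ring

end CrossedProduct

/-- An approximant can be rescaled so as not to exceed the norm of the approximated element. -/
theorem exists_mem_norm_le {C : Type*} [CStarAlgebra C] {D : NonUnitalStarSubalgebra ℂ C}
    {c b : C} {ε m : ℝ} (hm : 0 ≤ m) (hε : 0 < ε) (hb : b ∈ D) (hc : ‖c‖ ≤ m)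
    (hcb : ‖c - b‖ ≤ ε / 3) : ∃ b' ∈ D, ‖c - b'‖ < ε ∧ ‖b'‖ ≤ m := by
  have hs : 0 < m + ε / 3 := by positivity
  have hbn : ‖b‖ ≤ m + ε / 3 := by
    have : b = c - (c - b) := by abel
    rw [this]
    exact (norm_sub_le _ _).trans (add_le_add hc hcb)
  have ht : 0 ≤ m / (m + ε / 3) := by positivity
  -- As `‖b‖ ≤ m + ε/3`, this factor brings the norm down to `m` and moves `b` by at most `ε/3`.
  refine ⟨((m / (m + ε / 3) : ℝ) : ℂ) • b, SMulMemClass.smul_mem _ hb, ?_, ?_⟩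
  · have h1 : b - ((m / (m + ε / 3) : ℝ) : ℂ) • b = (((ε / 3) / (m + ε / 3) : ℝ) : ℂ) • b := by
      conv_lhs => enter [1]; rw [← one_smul ℂ b]
      rw [← sub_smul, ← Complex.ofReal_one, ← Complex.ofReal_sub]
      congr 2
      field_simp
      ring
    have h2 : ‖b - ((m / (m + ε / 3) : ℝ) : ℂ) • b‖ ≤ ε / 3 := by
      rw [h1, norm_smul, Complex.norm_real, Real.norm_of_nonneg (by positivity),
        div_mul_eq_mul_div, div_le_iff₀ hs]
      exact mul_le_mul_of_nonneg_left hbn (by positivity)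
    calc _ = ‖(c - b) + (b - ((m / (m + ε / 3) : ℝ) : ℂ) • b)‖ := by rw [sub_add_sub_cancel]
      _ ≤ ε / 3 + ε / 3 := (norm_add_le _ _).trans (add_le_add hcb h2)
      _ < ε := by linarith
  · rw [norm_smul, Complex.norm_real, Real.norm_of_nonneg ht, div_mul_eq_mul_div, div_le_iff₀ hs]
    exact mul_le_mul_of_nonneg_left hbn hm

end Approximation

end

/-! ### Assembly of the theorem. -/

theorem exists_partialIsometries {A G : Type*} [CStarAlgebra A] [Group G]
    (α : G →* (A ≃⋆ₐ[ℂ] A)) {e : G → A} (he : ∀ g, IsStarProjection (e g)) {δ : ℝ} (hδ1 : δ < 1)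
    (hα : ∀ g h, ‖α g (e h) - e (g * h)‖ ≤ δ) :
    ∃ w : G → A, w 1 = e 1 ∧ (∀ g, star (w g) * w g = α g⁻¹ (e g)) ∧
      (∀ g, w g * star (w g) = e 1) ∧ ∀ g, ‖w g - e 1‖ ≤ 2 * δ := by
  have hδ : 0 ≤ δ := (norm_nonneg _).trans (hα 1 1)
  have key : ∀ g, ∃ w, (g = 1 → w = e 1) ∧ star w * w = α g⁻¹ (e g) ∧ w * star w = e 1 ∧
      ‖w - e 1‖ ≤ 2 * δ := by
    intro g
    -- The choice `w 1 = e 1` makes the isomorphism restrict exactly, not just approximately, to the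
    -- inclusion on the first corner.
    by_cases hg : g = 1
    · subst hg
      refine ⟨e 1, fun _ => rfl, ?_, ?_, by rw [sub_self, norm_zero]; positivity⟩
      · rw [(he 1).isSelfAdjoint.star_eq, (he 1).isIdempotentElem.eq, inv_one, map_one,
          StarAlgEquiv.one_apply]
      · rw [(he 1).isSelfAdjoint.star_eq, (he 1).isIdempotentElem.eq]
    · have h1 : ‖α g⁻¹ (e g) - e 1‖ ≤ δ := by
        simpa using hα g⁻¹ g
      obtain ⟨w, h2, h3, h4⟩ := exists_star_mul_self_eq_of_norm_sub_lt_one ((he g).map (α g⁻¹))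
        (he 1) (h1.trans_lt hδ1)
      exact ⟨w, fun h => absurd h hg, h2, h3, by linarith⟩
  choose w h1 h2 h3 h4 using key
  exact ⟨w, h1 1 rfl, h2, h3, h4⟩

open CrossedProduct in
-- If `v` carries `s` under `P`, then `z y v` has initial projection `s`, and its range projection
-- `z (y v v⋆ y⋆) z` visibly lies in the hereditary subalgebra.
theorem mvNEquiv_hereditaryClosure_of_mvNSubequiv {A G : Type*} [CStarAlgebra A] [PartialOrder A]
    [StarOrderedRing A] [Group G] [Fintype G] [DecidableEq G] {α : G →* (A ≃⋆ₐ[ℂ] A)}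
    {z y : CrossedProduct α} (hz : IsSelfAdjoint z) {P s : A}
    (hy : star (z * y) * (z * y) = incl α P) (hs : IsStarProjection s) (h : MvNSubequiv s P) :
    ∃ p : CrossedProduct α, IsStarProjection p ∧ p ∈ hereditaryClosure z ∧
      MvNEquiv (incl α s) p := by
  obtain ⟨r, hr, hPr, v, hv, hvr⟩ := h
  have hPv : P * v = v := by
    rw [← mul_eq_self_of_mul_star_self hr hvr, ← mul_assoc, hPr]
  have h1 : star (z * y * incl α v) * (z * y * incl α v) = incl α s := by
    calc _ = star (incl α v) * (star (z * y) * (z * y)) * incl α v := by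
          simp only [star_mul, mul_assoc]
      _ = incl α s := by rw [hy, mul_assoc, ← map_mul, hPv, ← map_star, ← map_mul, hv]
  refine ⟨_, isStarProjection_mul_star (hs.map (incl α)) h1, subset_closure
    ⟨y * incl α v * star (y * incl α v), ?_⟩, _, h1, rfl⟩
  simp only [star_mul, hz.star_eq, mul_assoc]

theorem eq_norm_one_of_isStarProjection {A : Type*} [CStarAlgebra A] {q : A}
    (hq : IsStarProjection q) (hq0 : q ≠ 0) : ‖q‖ = 1 := by
  have h : ‖q‖ * ‖q‖ = ‖q‖ := by
    rw [← CStarRing.norm_star_mul_self, hq.isSelfAdjoint.star_eq, hq.isIdempotentElem.eq]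
  exact mul_left_cancel₀ (norm_ne_zero_iff.2 hq0) (h.trans (mul_one _).symm)

theorem mul_eq_of_mem_hereditaryClosure {A : Type*} [CStarAlgebra A] {p q : A}
    (hq : IsStarProjection q) (hp : p ∈ hereditaryClosure q) : q * p = p := by
  have hcl : IsClosed {a : A | q * a = a} := isClosed_eq (by fun_prop) continuous_id
  refine closure_minimal ?_ hcl hp
  rintro _ ⟨a, rfl⟩
  change q * (q * a * q) = q * a * q
  rw [← mul_assoc, ← mul_assoc, hq.isIdempotentElem.eq]

/-- Write `a = f a f` and replace the two factors `w` by `f` one at a time. -/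
theorem norm_star_mul_mul_sub_le {A : Type*} [CStarAlgebra A] {f w a : A} {η : ℝ}
    (hf : IsStarProjection f) (hw : w * star w = f) (hwf : ‖w - f‖ ≤ η) (ha : f * a * f = a) :
    ‖star w * a * w - a‖ ≤ 2 * η * ‖a‖ := by
  have hη : 0 ≤ η := (norm_nonneg _).trans hwf
  have hf1 := hf.norm_le_one'
  have hw0 : ‖w‖ ≤ 1 := by
    have h : ‖w‖ * ‖w‖ ≤ 1 := by
      rw [← CStarRing.norm_self_mul_star, hw]
      exact hf1
    nlinarith [norm_nonneg w]
  have h1 : star w * a * w - a = star (w - f) * a * w + f * a * (w - f) := by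
    conv_lhs => enter [2]; rw [← ha]
    rw [star_sub, hf.isSelfAdjoint.star_eq, sub_mul, sub_mul, mul_sub]
    abel
  rw [h1]
  calc _ ≤ η * ‖a‖ * 1 + 1 * ‖a‖ * η := by
        refine (norm_add_le _ _).trans (add_le_add ?_ ?_)
        · refine norm_mul₃_le.trans ?_
          rw [norm_star]
          gcongr
        · refine norm_mul₃_le.trans ?_
          gcongr
    _ = 2 * η * ‖a‖ := by ring

open CrossedProduct in
theorem mainTheorem5 {A G : Type*} [CStarAlgebra A] [PartialOrder A] [StarOrderedRing A]
    [Group G] [Fintype G] [DecidableEq G]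
    (hinf : ¬ FiniteDimensional ℂ A) (hfin : IsStablyFinite A) (hsimple : IsSimpleCStar A)
    (hrr : HasRealRankZero A) (hord : OrderDeterminedByTraces A)
    (α : G →* (A ≃⋆ₐ[ℂ] A)) (hα : HasTracialRokhlinProperty α)
    (F : Finset (CrossedProduct α)) (ε : ℝ) (hε : 0 < ε) (N : ℕ)
    (z : CrossedProduct α) (hz : 0 ≤ z) (hz0 : z ≠ 0) :
    ∃ (e : A) (he : IsStarProjection e)
      (D : NonUnitalStarSubalgebra ℂ (CrossedProduct α))
      (f : A) (hf : IsStarProjection f)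
      (φ : Matrix G G (corner f hf) ≃⋆ₐ[ℂ] D),
      -- `D` is a C⋆-subalgebra of the corner of `e`, containing the unit `e`
      IsClosed (D : Set (CrossedProduct α)) ∧
      D ≤ corner (CrossedProduct.incl α e) (he.map (CrossedProduct.incl α)) ∧
      CrossedProduct.incl α e ∈ D ∧
      -- (1)
      ((∀ a : corner f hf,
          (φ (Matrix.single 1 1 a) : CrossedProduct α) = CrossedProduct.incl α (a : A)) ∧
        ∀ g : G, ∃ b : A,
          (φ (Matrix.single g g (cornerUnit f hf)) : CrossedProduct α) =
            CrossedProduct.incl α b) ∧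
      -- (2)
      (∀ (g : G) (a : corner f hf),
        ‖(φ (Matrix.single g g a) : CrossedProduct α) - CrossedProduct.incl α (α g (a : A))‖ ≤
          ε * ‖(a : A)‖) ∧
      -- (3)
      (∀ a ∈ F, ∃ b₁ ∈ D, ∃ b₂ ∈ D,
        ‖CrossedProduct.incl α e * a - b₁‖ < ε ∧ ‖a * CrossedProduct.incl α e - b₂‖ < ε ∧
          ‖b₁‖ ≤ ‖a‖ ∧ ‖b₂‖ ≤ ‖a‖) ∧
      -- (4)
      CrossedProduct.incl α e =
        ∑ g : G, (φ (Matrix.single g g (cornerUnit f hf)) : CrossedProduct α) ∧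
      -- (5)
      (∃ p : CrossedProduct α, IsStarProjection p ∧ p ∈ hereditaryClosure z ∧
        MvNEquiv (1 - CrossedProduct.incl α e) p) ∧
      -- (6)
      (∃ q : Fin N → CrossedProduct α,
        (∀ i, IsStarProjection (q i)) ∧
        (∀ i j, i ≠ j → q i * q j = 0) ∧
        (∀ i, ∃ d ∈ D, q i = CrossedProduct.incl α e * d * CrossedProduct.incl α e) ∧
        ∀ i, MvNEquiv (q i) (1 - CrossedProduct.incl α e)) := by
  classical
  obtain ⟨P, hP, hP0, y, hy⟩ := exists_projection_of_nonneg α hrr hα hz hz0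
  -- The exponent is chosen for `N + 1 < 2^(N+1)`, the trace bound needed to fit `N` copies.
  obtain ⟨q, hq, hq0, hqP, hqτ⟩ := exists_small_projection hinf hsimple hrr hP hP0 (N + 1)
  choose c hc using ofCoeff_surjective (α := α)
  -- Adjoints are included because approximants of `a e` are obtained as adjoints of those of `e
  -- a⋆`.
  set F' := F ∪ F.image star with hF'
  -- The factor `5` is `δ + 2η = 5δ` with `η = 2δ`, the distance bound for the partial isometries.
  set K : CrossedProduct α → ℝ := fun a => ∑ h, Fintype.card G * (1 + ‖c a h‖ * 5) with hK
  have hK0 : ∀ a, 0 ≤ K a := fun a => Finset.sum_nonneg fun h _ => by positivity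
  set M := 1 + ∑ a ∈ F', K a with hM
  have hM1 : 0 < M := add_pos_of_pos_of_nonneg one_pos (Finset.sum_nonneg fun a _ => hK0 a)
  have hKM : ∀ a ∈ F', K a ≤ M := fun a ha => by
    have := Finset.single_le_sum (f := K) (fun a _ => hK0 a) ha
    linarith
  -- These bounds serve, in turn, the existence of the `w g` (which needs `δ < 1`), the diagonal
  -- estimate `2 · 2δ ≤ ε`, and the approximation within `ε/3` that leaves room for rescaling.
  set δ := min (1 / 2) (min (ε / 4) (ε / 3 / M)) with hδ
  have hδ0 : 0 < δ := by positivity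
  have hδ1 : δ < 1 := (min_le_left _ _).trans_lt (by norm_num)
  have hδ2 : 4 * δ ≤ ε := by
    have : δ ≤ ε / 4 := (min_le_right _ _).trans (min_le_left _ _)
    linarith
  have hδ3 : ∀ a ∈ F', K a * δ ≤ ε / 3 := fun a ha => by
    have h1 : δ ≤ ε / 3 / M := (min_le_right _ _).trans (min_le_right _ _)
    rw [le_div_iff₀ hM1, mul_comm] at h1
    exact (mul_le_mul_of_nonneg_right (hKM a ha) hδ0.le).trans h1
  obtain ⟨E, hE, hd, hαE, hcomm, ⟨p, hp, hpq, hEp⟩, -⟩ :=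
    hα (F'.biUnion fun a => Finset.univ.image (c a)) δ hδ0 q hq.nonneg
      (eq_norm_one_of_isStarProjection hq hq0)
  have hαE' : ∀ g h, ‖α g (E h) - E (g * h)‖ ≤ δ := fun g h => (hαE g h).le
  have hcomm' : ∀ a ∈ F', ∀ g h, ‖E g * c a h - c a h * E g‖ ≤ δ := fun a ha g h =>
    (hcomm g _ (Finset.mem_biUnion.2
      ⟨a, ha, Finset.mem_image_of_mem _ (Finset.mem_univ h)⟩)).le
  have he : IsStarProjection (∑ g, E g) :=
    IsStarProjection.finset_sum _ (fun g _ => hE g) fun g _ h _ => hd g h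
  have hsubq : MvNSubequiv (1 - ∑ g, E g) q := ⟨p, hp, mul_eq_of_mem_hereditaryClosure hq hpq, hEp⟩
  have hsubP : MvNSubequiv (1 - ∑ g, E g) P := hsubq.trans he.one_sub hqP
  obtain ⟨r, hr, hEr, hrd, hre⟩ := exists_diagonal_copies hrr hord hE hd N fun τ h => by
    have h1 := h.re_le_of_mvNSubequiv hq hsubq
    have h2 := (hqτ τ h).trans (h.re_le_one hP)
    have h3 := h.re_nonneg he.one_sub
    have h4 : (N : ℝ) + 1 < 2 ^ (N + 1) := by exact_mod_cast (N + 1).lt_two_pow_self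
    have h5 : (2 : ℝ) ^ (N + 1) * (τ (1 - ∑ g, E g)).re ≤ 1 :=
      (mul_le_mul_of_nonneg_left h1 (by positivity)).trans h2
    rcases h3.eq_or_lt with h6 | h6
    · rw [← h6]; norm_num
    · exact (mul_lt_mul_of_pos_right h4 h6).trans_le h5
  obtain ⟨w, hw1, hw, hw', hwn⟩ := exists_partialIsometries α hE hδ1 hαE'
  set v := rokhlinIsometry α w with hv
  have hvv := star_rokhlinIsometry_mul (α := α) hE hw hw' hd
  set π := cornerMatrixHom (incl α) (hE 1) v hvv with hπ
  have hvE : ∀ g, v g * star (v g) = incl α (E g) := rokhlinIsometry_mul_star hw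
  have hsumv : ∑ g, v g * star (v g) = incl α (∑ g, E g) := by
    rw [map_sum]
    exact Finset.sum_congr rfl fun g _ => hvE g
  set D := NonUnitalStarAlgHom.range π with hD
  have hmem : ∀ (a : A) (g h : G), v g * incl α a * star (v h) ∈ D := fun a g h =>
    mul_mul_star_mem_range a g h
  have hmem1 : ∀ g h : G, v g * star (v h) ∈ D := fun g h => by
    have := hmem 1 g h
    rwa [map_one, mul_one] at this
  -- Since `v g⋆ a v g` is again in `A`, every block `E g a E g = v g (v g⋆ a v g) v g⋆` belongs to
  -- `D`.
  have hdiag : ∀ (a : A) (g : G), incl α (E g * a * E g) ∈ D := fun a g => by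
    have h1 : incl α (E g * a * E g) = v g * (star (v g) * incl α a * v g) * star (v g) := by
      rw [map_mul, map_mul, ← hvE]
      simp only [mul_assoc]
    rw [h1, hv, star_incl_mul_rokhlinIsometry]
    exact hmem _ g g
  have hDle : D ≤ corner (incl α (∑ g, E g)) (he.map (incl α)) := fun x hx => by
    have := ((mem_range_cornerMatrixHom_iff x).1 hx).1
    rwa [hsumv] at this
  let φ : Matrix G G (corner (E 1) (hE 1)) ≃⋆ₐ[ℂ] D :=
    StarAlgEquiv.ofInjective' π (cornerMatrixHom_injective (incl_injective α))
  have hφ : ∀ g (a : corner (E 1) (hE 1)),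
      (φ (Matrix.single g g a) : CrossedProduct α) = incl α (α g (star (w g) * a * w g)) :=
    fun g a => (cornerMatrixHom_single (hv := hvv) g g a).trans (rokhlinIsometry_mul_incl_mul_star w g a)
  have hφ1 : ∀ g, (φ (Matrix.single g g (cornerUnit (E 1) (hE 1))) : CrossedProduct α) =
      incl α (E g) := fun g => by
    rw [hφ]
    change incl α (α g (star (w g) * E 1 * w g)) = _
    rw [mul_assoc, mul_eq_self_of_mul_star_self (hE 1) (hw' g), hw, act_act, mul_inv_cancel,
      map_one, StarAlgEquiv.one_apply]
  have happrox : ∀ a ∈ F', ∃ b ∈ D, ‖incl α (∑ g, E g) * a - b‖ < ε ∧ ‖b‖ ≤ ‖a‖ := by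
    intro a ha
    have h1 := norm_incl_sum_mul_sub_le hE hw' hαE' hwn (c a) (hcomm' a ha)
    rw [hc] at h1
    refine exists_mem_norm_le (norm_nonneg a) hε ?_ ?_ (h1.trans ?_)
    · exact sum_mem fun h _ => sum_mem fun g _ => mul_mem (hdiag _ g) (hmem1 _ _)
    · calc _ ≤ 1 * ‖a‖ := (norm_mul_le _ _).trans (mul_le_mul_of_nonneg_right
            (he.map (incl α)).norm_le_one' (norm_nonneg a))
        _ = ‖a‖ := one_mul _
    · refine le_trans (le_of_eq ?_) (hδ3 a ha)
      rw [hK, Finset.sum_mul]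
      refine Finset.sum_congr rfl fun h _ => ?_
      ring
  refine ⟨∑ g, E g, he, D, E 1, hE 1, φ, isClosed_range_cornerMatrixHom (incl_injective α), hDle,
    ?_, ⟨fun a => ?_, fun g => ⟨E g, hφ1 g⟩⟩, fun g a => ?_, fun a ha => ?_, ?_, ?_, ?_⟩
  · rw [← hsumv]
    exact sum_mem fun g _ => hmem1 g g
  · rw [hφ, hw1, map_one, StarAlgEquiv.one_apply, (hE 1).isSelfAdjoint.star_eq]
    exact congrArg (incl α) a.2
  · rw [hφ, ← map_sub, ← map_sub, norm_incl, norm_act]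
    have h1 : 2 * (2 * δ) ≤ ε := by linarith
    exact (norm_star_mul_mul_sub_le (hE 1) (hw' g) (hwn g) a.2).trans
      (mul_le_mul_of_nonneg_right h1 (norm_nonneg _))
  · obtain ⟨b₁, hb₁, h1, h1'⟩ := happrox a (Finset.mem_union_left _ ha)
    obtain ⟨b₂, hb₂, h2, h2'⟩ := happrox (star a)
      (Finset.mem_union_right _ (Finset.mem_image_of_mem _ ha))
    refine ⟨b₁, hb₁, star b₂, star_mem hb₂, h1, ?_, h1', by rwa [norm_star, ← norm_star a]⟩
    rw [← norm_star, star_sub, star_mul, star_star, (he.map (incl α)).isSelfAdjoint.star_eq]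
    exact h2
  · rw [map_sum]
    exact Finset.sum_congr rfl fun g _ => (hφ1 g).symm
  · have := mvNEquiv_hereditaryClosure_of_mvNSubequiv (.of_nonneg hz) hy he.one_sub hsubP
    rwa [map_sub, map_one] at this
  · have hrE : ∀ i g, r i g * E g = r i g := fun i g =>
      ((hE g).mul_eq_comm (hr i g)).1 (hEr i g)
    have hrsum : ∀ i, IsStarProjection (∑ g, r i g) := fun i =>
      IsStarProjection.finset_sum _ (fun g _ => hr i g) fun g _ h _ hgh => by
        rw [← hrE i g, ← hEr i h, mul_assoc, ← mul_assoc (E g), hd g h hgh, zero_mul, mul_zero]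
    -- Here the diagonal form of the copies is used: each `r i g` lies in the block of `E g`.
    have hrmem : ∀ i, incl α (∑ g, r i g) ∈ D := fun i => by
      rw [map_sum]
      refine sum_mem fun g _ => ?_
      have := hdiag (r i g) g
      rwa [hEr, hrE] at this
    refine ⟨fun i => incl α (∑ g, r i g), fun i => (hrsum i).map (incl α), fun i j hij => ?_,
      fun i => ⟨_, hrmem i, (hDle (hrmem i)).symm⟩, fun i => ?_⟩
    · rw [← map_mul, Finset.sum_mul, Finset.sum_eq_zero, map_zero]
      intro g _
      rw [Finset.mul_sum]
      refine Finset.sum_eq_zero fun h _ => ?_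
      by_cases hgh : g = h
      · subst hgh
        exact hrd i j hij g
      · rw [← hrE i g, ← hEr j h, mul_assoc, ← mul_assoc (E g), hd g h hgh, zero_mul, mul_zero]
    · obtain ⟨t, ht, ht'⟩ := (hre i).symm
      refine ⟨incl α t, ?_, ?_⟩
      · rw [← map_star, ← map_mul, ht]
      · rw [← map_star, ← map_mul, ht', map_sub, map_one]
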